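/- **Setting.** Let $K$ be a field, $L$ a first-order language and $T$ a model-complete $L$-theory (every embedding between models of $T$ is elementary). Let $r\in\mathbb N$, and suppose that parameter-free $L$-formulas $\Omega_{\mathbb V},\Omega_0,\Omega_+,(\Omega_q)_{q\in K}$ are given which define, in every model $\mathcal M\models T$, a nontrivial $K$-vector space $\mathbb V=\mathbb V(\mathcal M)$ whose underlying set is a set of $r$-tuples of elements of $M$ (its zero, the graph of its addition and the graphs of its scalar multiplications being defined by $\Omega_0,\Omega_+,\Omega_q$). Let $L_\theta$ be $L$ together with a new symbol $\theta$ for a map from $r$-tuples to $r$-tuples (i.e. $r$ new $r$-ary function symbols, the coordinates of $\theta$), and let $$T_\theta := T\cup\{\text{``}\theta|_{\mathbb V}\text{ is a }K\text{-linear endomorphism of }\mathbb V\text{''}\}\cup\{\forall x\notin\mathbb V:\ \theta(x)=0\}.$$ For $\rho=\sum_i(\rho)_iX^i\in K[X]$ let $\rho[\theta]:=\sum_i(\rho)_i\,\theta^i$, an endomorphism of $\mathbb V$. A model of $T_\theta$ is *existentially closed* if every existential $L_\theta$-sentence with parameters in it that holds in some extension which is again a model of $T_\theta$ already holds in it. For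 $s\in\mathbb N$ let $\vec x=(x_k^i : 1\le k\le s,\ i\in\mathbb N)$ be variables for vectors. For a model $(\mathcal M,\theta)$ of $T_\theta$ and an $L(M)$-formula $\psi(\vec x)$ (that is, an $L$-formula with parameters in $M$): * $\psi_\theta(x_1,\dots,x_s)$ denotes the result of replacing each $x_k^i$ by $\theta^i(x_k)$; * $\psi$ *implies a finite disjunction of non-trivial linear dependencies in $\vec x$ over $\mathbb V$* if there are finitely many pairs $(c_j,d_j)$, $j\in J$, where each $c_j=(c_{j,k,i})_{k,i}$ is a nonzero finitely supported family in $K$ and $d_j\in\mathbb V$, such that $\mathcal M\models\forall \vec x\in\mathbb V:\ \psi(\vec x)\rightarrow\bigvee_{j\in J}\sum_{k,i}c_{j,k,i}\,x_k^i=d_j$. **Theorem 3.40.** A model $(\mathcal M,\theta)$ of $T_\theta$ is an existentially closed model of $T_\theta$ if and only if $$(\mathcal M,\theta)\models\exists x_1,\dots,x_{m+n}\in\mathbb V:\ \psi_\theta(x_1,\dots,x_{m+n})\wedge\bigwedge_{k=1}^n\ \xi_k[\theta](x_{m+k})=\sum_{l=1}^mP_{k,l}[\theta](x_l)+v_k$$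 holds for all $m,n\in\mathbb N$ (including $0$) and all: 1. polynomials $\xi_1,\dots,\xi_n\in K[X]$ with $\deg(\xi_k)>0$ for all $k$, and polynomials $P_{k,l}\in K[X]$ $(1\le k\le n,\ 1\le l\le m)$; 2. $L(M)$-formulas $\psi(\vec x)$ in the variables $\vec x=(x_k^i:1\le k\le m+n,\ i\in\mathbb N)$ that do not imply any finite disjunction of non-trivial linear dependencies in $\vec x$ over $\mathbb V$ and in which, for $1\le k\le n$ and $i\ge\deg(\xi_k)$, the variable $x_{m+k}^i$ does not occur (freely); 3. $v_1,\dots,v_n\in\mathbb V$. -/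

import Mathlib

open FirstOrder

universe u v w k

namespace EndoVS

open FirstOrder.Language

/-- `T` is model complete: every embedding between models of `T` is elementary.
(All models range over one universe that is large enough for the language, so that by the
downward Löwenheim–Skolem theorem the choice of the parameter `w` is immaterial.) -/
def IsModelComplete {L : FirstOrder.Language.{u, v}} (T : L.Theory) : Prop :=
  ∀ (M N : Theory.ModelType.{u, v, max u v w} T) (f : M ↪[L] N) (n : ℕ)
    (φ : L.Formula (Fin n)) (a : Fin n → M), φ.Realize (f ∘ a) ↔ φ.Realize a

/-- `M` is an existentially closed model of `T`: it is a model of `T`, and every existential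
formula with parameters from `M` that holds in an extension of `M` which is a model of `T`
already holds in `M`.  An element of `L.Formula M` evaluated at the identity is a sentence with
parameters from `M`. -/
def IsExistentiallyClosed {L : FirstOrder.Language.{u, v}} (T : L.Theory)
    (M : Type (max u v w)) [L.Structure M] : Prop :=
  M ⊨ T ∧
    ∀ (N : Theory.ModelType.{u, v, max u v w} T) (f : M ↪[L] N) (φ : L.Formula M),
      BoundedFormula.IsExistential φ → φ.Realize f → φ.Realize id

/-! ### Definable vector spaces -/

/-- Parameter-free `L`-formulas intended to define a `K`-vector space, whose vectors are
`r`-tuples: the universe, zero, the graph of addition, the graphs of the scalar multiplications.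
A variable `(i, j)` is the `j`-th coordinate of the `i`-th vector. -/
structure VectorSpaceFormulas (K : Type k) (L : FirstOrder.Language.{u, v}) (r : ℕ) where
  /-- the set of vectors -/
  carrier : L.Formula (Fin r)
  /-- `x = 0` -/
  zero : L.Formula (Fin r)
  /-- `x + y = z` -/
  add : L.Formula (Fin 3 × Fin r)
  /-- `q • x = y` -/
  smul : K → L.Formula (Fin 2 × Fin r)

namespace VectorSpaceFormulas

variable {K : Type k} {L : FirstOrder.Language.{u, v}} {r : ℕ}

/-- The set `𝕍` of vectors in the structure `M`. -/
def Vec (Ω : VectorSpaceFormulas K L r) (M : Type*) [L.Structure M] : Type _ :=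
  {x : Fin r → M // Ω.carrier.Realize x}

/-- The given addition and scalar multiplication on `𝕍` are those defined by the formulas. -/
structure Compatible [Field K] (Ω : VectorSpaceFormulas K L r) (M : Type*) [L.Structure M]
    (A : AddCommGroup (Ω.Vec M)) (_B : Module K (Ω.Vec M)) : Prop where
  zero_iff : ∀ a : Ω.Vec M, Ω.zero.Realize a.1 ↔ a = 0
  add_iff : ∀ a : Fin 3 → Ω.Vec M,
    Ω.add.Realize (fun p => (a p.1).1 p.2) ↔ a 0 + a 1 = a 2
  smul_iff : ∀ (q : K) (a : Fin 2 → Ω.Vec M),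
    (Ω.smul q).Realize (fun p => (a p.1).1 p.2) ↔ q • a 0 = a 1

/-- In the structure `M` the formulas define a nontrivial `K`-vector space. -/
def DefineVectorSpace [Field K] (Ω : VectorSpaceFormulas K L r)
    (M : Type*) [L.Structure M] : Prop :=
  Nontrivial (Ω.Vec M) ∧
    ∃ (A : AddCommGroup (Ω.Vec M)) (B : Module K (Ω.Vec M)), Ω.Compatible M A B

end VectorSpaceFormulas

/-- Formulas that define a nontrivial `K`-vector space in every model of `T`. -/
structure DefinableVectorSpace (K : Type k) [Field K] {L : FirstOrder.Language.{u, v}} (T : L.Theory)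
    (r : ℕ) extends VectorSpaceFormulas K L r where
  defineVectorSpace : ∀ M : Theory.ModelType.{u, v, max u v w} T,
    toVectorSpaceFormulas.DefineVectorSpace M

/-! ### The language and the theory of an endomorphism -/

/-- The function symbols `θ₁, …, θᵣ`, each of arity `r`: the coordinates of a map `θ` on
`r`-tuples. -/
inductive ThetaFunctions (r : ℕ) : ℕ → Type
  | coord (j : Fin r) : ThetaFunctions r r

/-- The language `{θ}`. -/
def thetaLang (r : ℕ) : FirstOrder.Language.{0, 0} :=
  ⟨ThetaFunctions r, fun _ => Empty⟩

/-- The language `L ∪ {θ}`.  An `L ∪ {θ}`-structure is an `L`-structure together with a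
`{θ}`-structure on the same set. -/
abbrev withTheta (L : FirstOrder.Language.{u, v}) (r : ℕ) : FirstOrder.Language.{u, v} :=
  L.sum (thetaLang r)

/-- The map `θ : M ^ r → M ^ r` of a structure. -/
def thetaMap {r : ℕ} (M : Type*) [(thetaLang r).Structure M] (x : Fin r → M) : Fin r → M :=
  fun j => Structure.funMap (L := thetaLang r) (ThetaFunctions.coord j) x

/-- The `j`-th coordinate of `θ(t)` for an `r`-tuple of terms `t`. -/
def thetaTerm {L : FirstOrder.Language.{u, v}} {r : ℕ} {α : Type*} (t : Fin r → (withTheta L r).Term α)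
    (j : Fin r) : (withTheta L r).Term α :=
  Term.func (L := withTheta L r) (Sum.inr (ThetaFunctions.coord j)) t

/-- The universal closure of a formula. -/
noncomputable def allClosure {L : FirstOrder.Language.{u, v}} {α : Type} [Finite α] (φ : L.Formula α) :
    L.Sentence :=
  Formula.iAlls (α := Empty) α (φ.relabel Sum.inr)

namespace VectorSpaceFormulas

variable {K : Type k} {L : FirstOrder.Language.{u, v}} {r : ℕ}

/-- `t ∈ 𝕍`, as an `L ∪ {θ}`-formula. -/
def memF (Ω : VectorSpaceFormulas K L r) {α : Type} (t : Fin r → (withTheta L r).Term α) :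
    (withTheta L r).Formula α :=
  BoundedFormula.subst (LHom.sumInl.onFormula Ω.carrier) t

/-- `t = 0`, as an `L ∪ {θ}`-formula. -/
def zeroF (Ω : VectorSpaceFormulas K L r) {α : Type} (t : Fin r → (withTheta L r).Term α) :
    (withTheta L r).Formula α :=
  BoundedFormula.subst (LHom.sumInl.onFormula Ω.zero) t

/-- `t₀ + t₁ = t₂`, as an `L ∪ {θ}`-formula. -/
def addF (Ω : VectorSpaceFormulas K L r) {α : Type}
    (t : Fin 3 → Fin r → (withTheta L r).Term α) : (withTheta L r).Formula α :=
  BoundedFormula.subst (LHom.sumInl.onFormula Ω.add) (fun p => t p.1 p.2)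

/-- `q • t₀ = t₁`, as an `L ∪ {θ}`-formula. -/
def smulF (Ω : VectorSpaceFormulas K L r) (q : K) {α : Type}
    (t : Fin 2 → Fin r → (withTheta L r).Term α) : (withTheta L r).Formula α :=
  BoundedFormula.subst (LHom.sumInl.onFormula (Ω.smul q)) (fun p => t p.1 p.2)

/-- The `i`-th vector of variables. -/
def varVec {s : ℕ} (i : Fin s) : Fin r → (withTheta L r).Term (Fin s × Fin r) :=
  fun j => Term.var (i, j)

/-- `∀ x ∈ 𝕍, θ(x) ∈ 𝕍`. -/
noncomputable def axMem (Ω : VectorSpaceFormulas K L r) : (withTheta L r).Sentence :=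
  allClosure (α := Fin 1 × Fin r)
    (Ω.memF (varVec 0) ⟹ Ω.memF (thetaTerm (varVec 0)))

/-- `∀ x y z ∈ 𝕍, x + y = z → θ(x) + θ(y) = θ(z)`. -/
noncomputable def axAdd (Ω : VectorSpaceFormulas K L r) : (withTheta L r).Sentence :=
  allClosure (α := Fin 3 × Fin r)
    (((Ω.memF (varVec 0) ⊓ Ω.memF (varVec 1)) ⊓ Ω.memF (varVec 2)) ⟹
      (Ω.addF varVec ⟹ Ω.addF (fun i => thetaTerm (varVec i))))

/-- `∀ x y ∈ 𝕍, q • x = y → q • θ(x) = θ(y)`. -/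
noncomputable def axSmul (Ω : VectorSpaceFormulas K L r) (q : K) : (withTheta L r).Sentence :=
  allClosure (α := Fin 2 × Fin r)
    ((Ω.memF (varVec 0) ⊓ Ω.memF (varVec 1)) ⟹
      (Ω.smulF q varVec ⟹ Ω.smulF q (fun i => thetaTerm (varVec i))))

/-- `∀ x ∉ 𝕍, θ(x) = 0`. -/
noncomputable def axOutside (Ω : VectorSpaceFormulas K L r) : (withTheta L r).Sentence :=
  allClosure (α := Fin 1 × Fin r)
    (∼(Ω.memF (varVec 0)) ⟹
      (Ω.memF (thetaTerm (varVec 0)) ⊓ Ω.zeroF (thetaTerm (varVec 0))))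

end VectorSpaceFormulas

section Realize

variable {K : Type k} {L : FirstOrder.Language.{u, v}} {r : ℕ}
  {M : Type*} [L.Structure M] [(thetaLang r).Structure M]

theorem realize_allClosure {L' : FirstOrder.Language.{u, v}} [L'.Structure M] {α : Type} [Finite α]
    (φ : L'.Formula α) : M ⊨ allClosure φ ↔ ∀ x : α → M, φ.Realize x := by
  simp only [allClosure, Sentence.Realize, Formula.realize_iAlls, Formula.realize_relabel]
  exact Iff.rfl

variable (Ω : VectorSpaceFormulas K L r)

theorem realize_thetaTerm {α : Type*} (t : Fin r → (withTheta L r).Term α) (x : α → M) :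
    (fun j => (thetaTerm t j).realize x) = thetaMap M (fun j => (t j).realize x) := rfl

theorem realize_memF {α : Type} (t : Fin r → (withTheta L r).Term α) (x : α → M) :
    (Ω.memF t).Realize x ↔ Ω.carrier.Realize (fun j => (t j).realize x) := by
  unfold VectorSpaceFormulas.memF Formula.Realize
  rw [BoundedFormula.realize_subst]
  exact LHom.realize_onFormula _ _

theorem realize_zeroF {α : Type} (t : Fin r → (withTheta L r).Term α) (x : α → M) :
    (Ω.zeroF t).Realize x ↔ Ω.zero.Realize (fun j => (t j).realize x) := by
  unfold VectorSpaceFormulas.zeroF Formula.Realize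
  rw [BoundedFormula.realize_subst]
  exact LHom.realize_onFormula _ _

theorem realize_addF {α : Type} (t : Fin 3 → Fin r → (withTheta L r).Term α) (x : α → M) :
    (Ω.addF t).Realize x ↔ Ω.add.Realize (fun p => (t p.1 p.2).realize x) := by
  unfold VectorSpaceFormulas.addF Formula.Realize
  rw [BoundedFormula.realize_subst]
  exact LHom.realize_onFormula _ _

theorem realize_smulF (q : K) {α : Type} (t : Fin 2 → Fin r → (withTheta L r).Term α)
    (x : α → M) :
    (Ω.smulF q t).Realize x ↔ (Ω.smul q).Realize (fun p => (t p.1 p.2).realize x) := by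
  unfold VectorSpaceFormulas.smulF Formula.Realize
  rw [BoundedFormula.realize_subst]
  exact LHom.realize_onFormula _ _

end Realize

variable {K : Type k} [Field K] {L : FirstOrder.Language.{u, v}} {T : L.Theory} {r : ℕ}

/-- The `L ∪ {θ}`-theory `T_θ`: the theory `T`, together with the statements that `θ` restricts to
an endomorphism of the `K`-vector space `𝕍` and is zero outside `𝕍`. -/
noncomputable def DefinableVectorSpace.thetaTheory (V : DefinableVectorSpace.{u, v, w, k} K T r) :
    (withTheta L r).Theory :=
  LHom.sumInl.onTheory T ∪ {V.axMem, V.axAdd, V.axOutside} ∪ Set.range V.axSmul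

/-! ### The vector space and the endomorphism of a model of `T_θ` -/

section Model

variable (V : DefinableVectorSpace.{u, v, w, k} K T r)
  (M : Type (max u v w)) [L.Structure M] [(thetaLang r).Structure M]

theorem model_of_thetaTheory (hM : M ⊨ V.thetaTheory) : M ⊨ T := by
  have h : M ⊨ (LHom.sumInl : L →ᴸ withTheta L r).onTheory T :=
    hM.mono fun _ hφ => Or.inl (Or.inl hφ)
  exact (LHom.onTheory_model _ T).1 h

theorem exists_vectorSpace [Nonempty M] (hM : M ⊨ V.thetaTheory) :
    ∃ (A : AddCommGroup (V.Vec M)) (B : Module K (V.Vec M)), V.Compatible M A B :=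
  haveI := model_of_thetaTheory V M hM
  (V.defineVectorSpace (Theory.ModelType.of T M)).2

/-- The addition of `𝕍`, defined by the given formulas. -/
noncomputable instance instAddCommGroupVec [Nonempty M] [hM : M ⊨ V.thetaTheory] :
    AddCommGroup (V.Vec M) :=
  (exists_vectorSpace V M hM).choose

/-- The scalar multiplication of `𝕍`, defined by the given formulas. -/
noncomputable instance instModuleVec [Nonempty M] [hM : M ⊨ V.thetaTheory] :
    Module K (V.Vec M) :=
  (exists_vectorSpace V M hM).choose_spec.choose

theorem compatible [Nonempty M] [hM : M ⊨ V.thetaTheory] :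
    V.Compatible M (instAddCommGroupVec V M) (instModuleVec V M) :=
  (exists_vectorSpace V M hM).choose_spec.choose_spec

variable {M}

theorem thetaMap_mem [hM : M ⊨ V.thetaTheory] (x : V.Vec M) :
    V.carrier.Realize (thetaMap M x.1) := by
  have h : M ⊨ V.axMem := hM.realize_of_mem _ (Or.inl (Or.inr (Or.inl rfl)))
  have h1 := (realize_allClosure _).1 h (fun p => x.1 p.2)
  rw [Formula.realize_imp, realize_memF, realize_memF, realize_thetaTerm] at h1
  exact h1 x.2

variable (M)

/-- The restriction of `θ` to `𝕍`. -/
def thetaVec [M ⊨ V.thetaTheory] (x : V.Vec M) : V.Vec M :=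
  ⟨thetaMap M x.1, thetaMap_mem V x⟩

theorem thetaVec_add [Nonempty M] [hM : M ⊨ V.thetaTheory] (x y : V.Vec M) :
    thetaVec V M (x + y) = thetaVec V M x + thetaVec V M y := by
  have h : M ⊨ V.axAdd := hM.realize_of_mem _ (Or.inl (Or.inr (Or.inr (Or.inl rfl))))
  let a : Fin 3 → V.Vec M := ![x, y, x + y]
  have h1 := (realize_allClosure _).1 h (fun p => (a p.1).1 p.2)
  simp only [Formula.realize_imp, Formula.realize_inf, realize_memF, realize_addF] at h1
  have ha := ((compatible V M).add_iff a).2 rfl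
  exact (((compatible V M).add_iff (fun i => thetaVec V M (a i))).1
    (h1 ⟨⟨(a 0).2, (a 1).2⟩, (a 2).2⟩ ha)).symm

theorem thetaVec_smul [Nonempty M] [hM : M ⊨ V.thetaTheory] (q : K) (x : V.Vec M) :
    thetaVec V M (q • x) = q • thetaVec V M x := by
  have h : M ⊨ V.axSmul q := hM.realize_of_mem _ (Or.inr ⟨q, rfl⟩)
  let a : Fin 2 → V.Vec M := ![x, q • x]
  have h1 := (realize_allClosure _).1 h (fun p => (a p.1).1 p.2)
  simp only [Formula.realize_imp, Formula.realize_inf, realize_memF, realize_smulF] at h1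
  have ha := ((compatible V M).smul_iff q a).2 rfl
  exact (((compatible V M).smul_iff q (fun i => thetaVec V M (a i))).1
    (h1 ⟨(a 0).2, (a 1).2⟩ ha)).symm

/-- The endomorphism `θ` of the vector space `𝕍` in a model of `T_θ`.  For a polynomial `ρ`, the
endomorphism `ρ[θ]` is `Polynomial.aeval (theta V M) ρ`. -/
noncomputable def theta [Nonempty M] [M ⊨ V.thetaTheory] : Module.End K (V.Vec M) where
  toFun := thetaVec V M
  map_add' := thetaVec_add V M
  map_smul' := thetaVec_smul V M

variable {M}

/-- The `L(M)`-formula `ψ` in the variables `(k, i, j)` (the `j`-th coordinate of the vector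
variable `x_k^i`, for `k < s`, `i ∈ ℕ`) implies a finite disjunction of non-trivial linear
dependencies `∑ c_{k,i} • x_k^i = d`, where `c ≠ 0` and `d ∈ 𝕍`, the variables `x_k^i` ranging
over `𝕍`. -/
def ImpliesLinearDependency [Nonempty M] [M ⊨ V.thetaTheory] {s : ℕ}
    (ψ : L[[M]].Formula (Fin s × ℕ × Fin r)) : Prop :=
  ∃ D : Finset (((Fin s × ℕ) →₀ K) × V.Vec M), (∀ δ ∈ D, δ.1 ≠ 0) ∧
    ∀ x : Fin s × ℕ → V.Vec M, ψ.Realize (fun p => (x (p.1, p.2.1)).1 p.2.2) →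
      ∃ δ ∈ D, (δ.1.sum fun p c => c • x p) = δ.2

/-- `ψ_θ(x)` holds: the `L(M)`-formula `ψ` holds when each `x_k^i` is replaced by `θ^i(x_k)`. -/
def RealizeTheta [Nonempty M] [M ⊨ V.thetaTheory] {s : ℕ}
    (ψ : L[[M]].Formula (Fin s × ℕ × Fin r)) (x : Fin s → V.Vec M) : Prop :=
  ψ.Realize (fun p => ((theta V M ^ p.2.1) (x p.1)).1 p.2.2)

end Model

end EndoVS

namespace EndoVS

open FirstOrder.Language

/-! ### Formulas and their free variables -/

section Formulas

variable {L : FirstOrder.Language.{u, v}}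

/-! The mechanism is that an endomorphism may be prescribed freely on vectors that are linearly
independent over `𝕍(M)`, while model completeness of `T` makes every embedding of models
`L`-elementary.

Necessity. If `ψ` implies no finite disjunction of dependencies, compactness realizes it in an
elementary `L`-extension `N` by vectors `x_k^i` independent over `𝕍(M)`
(`exists_independent_realization`). The map `θ` extends to `𝕍(N)` by the shift `x_k^i ↦ x_k^{i+1}`,
except that the image of the last relevant vector of a constrained orbit is dictated by the equation
for `ξ_k` (`exists_extension`). This gives a model of `T_θ` extending `M` in which the system is
solved. By existential closedness it embeds over `M` into an elementary extension of `M`. That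
embedding is `L`-elementary, so even a non-existential `ψ` survives, and the solution descends to
`M`.

Sufficiency. Let `N` be an extension that models `T_θ`; it is `L`-elementary over `M`. Finitely many
vectors of `𝕍(N)` generate a finite `K[X]`-module modulo `𝕍(M)`. Since `K[X]` is a PID, this is a
direct sum of cyclic modules, so there are generators `x_k` whose relations over `𝕍(M)` all follow
from equations `ξ_k[θ](x_{m+k}) = v_k` (`exists_generators_mod`). A finite piece of the `L`-diagram
of `N` becomes a formula `ψ` in the vectors `θ^i(x_k)`, with `i < deg ξ_k` for the torsion
generators. These are independent over `𝕍(M)`, so `ψ` implies no dependencies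
(`not_impliesLinearDependency`). The axiom gives a solution in `M`, which satisfies all relations of
the original generators, in particular those that describe `θ` (`exists_finite_reflection`).
Compactness then embeds `N` over `M` into an elementary extension of `M`. -/

theorem realize_congr_freeVar {α : Type*} [DecidableEq α] {M : Type*} [L.Structure M]
    (φ : L.Formula α) {x y : α → M} (h : ∀ a ∈ φ.freeVarFinset, x a = y a) :
    φ.Realize x ↔ φ.Realize y := by
  have h1 := BoundedFormula.realize_restrictFreeVar (φ := φ) (f := id) (v := fun a => x a)
    (xs := default) x (fun _ => rfl)
  have h2 := BoundedFormula.realize_restrictFreeVar (φ := φ) (f := id) (v := fun a => x a)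
    (xs := default) y (fun a => h a a.2)
  exact h1.symm.trans h2

theorem mem_varFinsetLeft_relabel {α β γ δ : Type*} [DecidableEq α] [DecidableEq β]
    (g : α → β) (g' : γ → δ) (t : L.Term (α ⊕ γ)) {b : β}
    (hb : b ∈ (t.relabel (Sum.map g g')).varFinsetLeft) :
    ∃ a ∈ t.varFinsetLeft, g a = b := by
  induction t with
  | var x =>
    rcases x with a | c
    · have hb' : b = g a := by simpa [Term.relabel, Term.varFinsetLeft] using hb
      exact ⟨a, by simp [Term.varFinsetLeft], hb'.symm⟩
    · simp [Term.relabel, Term.varFinsetLeft] at hb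
  | func f ts ih =>
    simp only [Term.relabel, Term.varFinsetLeft, Finset.mem_biUnion, Finset.mem_univ,
      true_and] at hb ⊢
    obtain ⟨i, hi⟩ := hb
    obtain ⟨a, ha, hab⟩ := ih i hi
    exact ⟨a, ⟨i, ha⟩, hab⟩

theorem mem_varFinsetLeft_relabelAux {α β : Type*} [DecidableEq α] [DecidableEq β]
    (g : α → β) (k : ℕ) (t : L.Term (α ⊕ Fin k)) {b : β}
    (hb : b ∈ (t.relabel (BoundedFormula.relabelAux (n := 0) (Sum.inl ∘ g) k)).varFinsetLeft) :
    ∃ a ∈ t.varFinsetLeft, g a = b := by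
  have h : (BoundedFormula.relabelAux (n := 0) (Sum.inl ∘ g) k : α ⊕ Fin k → _) =
      Sum.map g (Fin.natAdd 0) := by
    funext x
    rcases x with a | c <;> rfl
  rw [h] at hb
  exact mem_varFinsetLeft_relabel g _ t hb

theorem mem_freeVarFinset_relabel_aux {α β : Type*} [DecidableEq α] [DecidableEq β]
    (g : α → β) {k : ℕ} (φ : L.BoundedFormula α k) {b : β}
    (hb : b ∈ (φ.relabel (n := 0) (Sum.inl ∘ g : α → β ⊕ Fin 0)).freeVarFinset) :
    ∃ a ∈ φ.freeVarFinset, g a = b := by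
  induction φ with
  | falsum => simp at hb
  | equal t₁ t₂ =>
    simp only [BoundedFormula.relabel, BoundedFormula.mapTermRel, BoundedFormula.freeVarFinset,
      Finset.mem_union] at hb ⊢
    rcases hb with hb | hb
    · obtain ⟨a, ha, rfl⟩ := mem_varFinsetLeft_relabelAux g _ _ hb
      exact ⟨a, Or.inl ha, rfl⟩
    · obtain ⟨a, ha, rfl⟩ := mem_varFinsetLeft_relabelAux g _ _ hb
      exact ⟨a, Or.inr ha, rfl⟩
  | rel R ts =>
    simp only [BoundedFormula.relabel, BoundedFormula.mapTermRel, BoundedFormula.freeVarFinset,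
      Finset.mem_biUnion, Finset.mem_univ, true_and] at hb ⊢
    obtain ⟨i, hi⟩ := hb
    obtain ⟨a, ha, rfl⟩ := mem_varFinsetLeft_relabelAux g _ _ hi
    exact ⟨a, ⟨i, ha⟩, rfl⟩
  | imp φ₁ φ₂ ih₁ ih₂ =>
    rw [BoundedFormula.relabel_imp] at hb
    simp only [BoundedFormula.freeVarFinset, Finset.mem_union] at hb ⊢
    rcases hb with hb | hb
    · obtain ⟨a, ha, rfl⟩ := ih₁ hb
      exact ⟨a, Or.inl ha, rfl⟩
    · obtain ⟨a, ha, rfl⟩ := ih₂ hb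
      exact ⟨a, Or.inr ha, rfl⟩
  | all φ ih =>
    rw [BoundedFormula.relabel_all] at hb
    exact ih hb

/-- This serves the variable condition on `ψ`: the formula built in `exists_finite_reflection` is
relabelled from one whose variables are all admissible. -/
theorem mem_freeVarFinset_relabel {α β : Type*} [DecidableEq α] [DecidableEq β]
    (g : α → β) (φ : L.Formula α) {b : β} (hb : b ∈ (φ.relabel g).freeVarFinset) :
    ∃ a ∈ φ.freeVarFinset, g a = b :=
  mem_freeVarFinset_relabel_aux g φ hb

/-- The formula with parameters from `M` as a formula with variables for the parameters. -/
def paramsToVars {M α : Type*} (φ : L[[M]].Formula α) : L.Formula (M ⊕ α) :=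
  BoundedFormula.constantsVarsEquiv φ

theorem realize_paramsToVars {M α : Type*} [L.Structure M] (φ : L[[M]].Formula α) (x : α → M) :
    (paramsToVars φ).Realize (Sum.elim id x) ↔ φ.Realize x :=
  BoundedFormula.realize_constantsVarsEquiv (φ := φ) (v := x) (xs := default)

theorem paramsToVars_symm {M α : Type*} (φ : L.Formula (M ⊕ α)) :
    paramsToVars (BoundedFormula.constantsVarsEquiv.symm φ : L[[M]].Formula α) = φ :=
  Equiv.apply_symm_apply _ _

/-- Formulas over `M` are evaluated in several extensions of `M`, so their parameters are read
through an arbitrary map `f`, which turns `N` into a structure with constants for `M`. -/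
theorem realize_paramsToVars_congr {M N α : Type*} [L.Structure N] [DecidableEq α]
    (φ : L[[M]].Formula α) (f : M → N) {x y : α → N} (h : ∀ a ∈ φ.freeVarFinset, x a = y a) :
    (paramsToVars φ).Realize (Sum.elim f x) ↔ (paramsToVars φ).Realize (Sum.elim f y) := by
  let _ : (constantsOn M).Structure N := constantsOn.structure f
  have key (z : α → N) : (paramsToVars φ).Realize (Sum.elim f z) ↔ φ.Realize z :=
    BoundedFormula.realize_constantsVarsEquiv (φ := φ) (v := z) (xs := default)
  rw [key, key]
  exact realize_congr_freeVar φ h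

theorem realize_paramsToVars_relabel {M N α β : Type*} [L.Structure N]
    (φ : L[[M]].Formula α) (g : α → β) (f : M → N) (x : β → N) :
    (paramsToVars (φ.relabel g)).Realize (Sum.elim f x) ↔
      (paramsToVars φ).Realize (Sum.elim f (x ∘ g)) := by
  let _ : (constantsOn M).Structure N := constantsOn.structure f
  have key {γ : Type _} (χ : L[[M]].Formula γ) (z : γ → N) :
      (paramsToVars χ).Realize (Sum.elim f z) ↔ χ.Realize z :=
    BoundedFormula.realize_constantsVarsEquiv (φ := χ) (v := z) (xs := default)
  have key' : (paramsToVars (φ.relabel g)).Realize (Sum.elim f x) ↔ (φ.relabel g).Realize x :=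
    BoundedFormula.realize_constantsVarsEquiv (φ := φ.relabel g) (v := x) (xs := default)
  rw [key', key, Formula.realize_relabel]

end Formulas

/-! ### Types, embeddings and existential closedness -/

section Types

variable {L : FirstOrder.Language.{u, v}}

/-- A set of formulas that is finitely satisfiable in `M` is realized in an elementary
extension of `M`. -/
theorem exists_realize_type (M : Type w) [Nonempty M] [L.Structure M] {X : Type k} (Γ : Set (L.Formula (M ⊕ X)))
    (h : ∀ Γ₀ : Finset (L.Formula (M ⊕ X)), ↑Γ₀ ⊆ Γ →
      ∃ g : X → M, ∀ γ ∈ Γ₀, γ.Realize (Sum.elim id g)) :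
    ∃ (N : Type (max u v w k)) (_ : L.Structure N) (_ : Nonempty N) (e : M ↪ₑ[L] N) (g : X → N),
      ∀ γ ∈ Γ, γ.Realize (Sum.elim e g) := by
  classical
  have h' : ∀ Δ : Finset Γ, ∃ g : X → M, ∀ γ ∈ Δ, γ.1.Realize (Sum.elim id g) := by
    intro Δ
    obtain ⟨g, hg⟩ := h (Δ.image Subtype.val) (by
      intro γ hγ
      obtain ⟨δ, -, rfl⟩ := Finset.mem_image.1 hγ
      exact δ.2)
    exact ⟨g, fun γ hγ => hg _ (Finset.mem_image_of_mem _ hγ)⟩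
  choose g hg using h'
  -- The extension is an ultrapower indexed by the finite parts of `Γ`. The ultrafilter refines
  -- `atTop`, so almost every index contains a given formula `γ`, and the chosen assignments satisfy
  -- it there.
  let U : Ultrafilter (Finset Γ) := Ultrafilter.of Filter.atTop
  let e : M ↪ₑ[L] ((U : Filter (Finset Γ)).Product fun _ => M) :=
    { toFun := fun m => ((fun _ => m : Finset Γ → M) : (U : Filter (Finset Γ)).Product fun _ => M)
      map_formula' := by
        intro n φ x
        refine (Ultraproduct.realize_formula_cast φ (fun i _ => x i)).trans ?_
        exact Filter.eventually_const }
  refine ⟨(U : Filter (Finset Γ)).Product fun _ => M, inferInstance, inferInstance, e,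
    fun a => ((fun Δ => g Δ a : Finset Γ → M) : (U : Filter (Finset Γ)).Product fun _ => M), ?_⟩
  intro γ hγ
  have h1 := Ultraproduct.realize_formula_cast (M := fun _ : Finset Γ => M) (u := U) γ
    (fun a Δ => (Sum.elim id (g Δ) a : M))
  have h2 : ∀ᶠ Δ : Finset Γ in U, γ.Realize (fun a => (Sum.elim id (g Δ) a : M)) := by
    refine (Ultrafilter.of_le Filter.atTop) ?_
    refine Filter.mem_of_superset (Filter.mem_atTop ({⟨γ, hγ⟩} : Finset Γ)) ?_
    intro Δ hΔ
    exact hg Δ ⟨γ, hγ⟩ (hΔ (Finset.mem_singleton_self _))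
  have h3 := h1.2 h2
  refine Eq.mp (congrArg γ.Realize (funext fun a => ?_)) h3
  rcases a with a | a <;> rfl

/-- A formula with parameters that is satisfiable in an elementary extension is satisfiable. -/
theorem exists_realize_of_elementary {M N : Type*} [L.Structure M] [L.Structure N]
    (e : M ↪ₑ[L] N) {α : Type*} [Finite α] (φ : L.Formula (M ⊕ α)) (x : α → N)
    (h : φ.Realize (Sum.elim e x)) : ∃ y : α → M, φ.Realize (Sum.elim id y) := by
  have h1 : (Formula.iExs α φ).Realize (e ∘ (id : M → M)) := Formula.realize_iExs.2 ⟨x, h⟩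
  exact Formula.realize_iExs.1 ((e.map_formula _ _).1 h1)

/-- A map that preserves quantifier-free formulas is an embedding. -/
def embeddingOfQF {M N : Type*} [L.Structure M] [L.Structure N] (g : M → N)
    (hg : ∀ φ : L.Formula M, BoundedFormula.IsQF φ → φ.Realize id → φ.Realize g) : M ↪[L] N where
  toFun := g
  inj' := by
    intro a b hab
    by_contra hne
    let φ : L.Formula M := ∼(Term.equal (Term.var a) (Term.var b))
    have hφ : BoundedFormula.IsQF φ := (BoundedFormula.IsAtomic.equal _ _).isQF.not
    have h2 := hg φ hφ fun hab' => hne (Formula.realize_equal.1 hab')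
    exact h2 (Formula.realize_equal.2 hab)
  map_fun' := by
    intro n f x
    let φ : L.Formula M := Term.equal (Term.func f fun i => Term.var (x i))
      (Term.var (Structure.funMap f x))
    have h2 := hg φ (BoundedFormula.IsAtomic.equal _ _).isQF (by
      simp [φ, Formula.realize_equal])
    simp only [φ, Formula.realize_equal, Term.realize] at h2
    exact h2.symm
  map_rel' := by
    intro n R x
    let φ : L.Formula M := Relations.formula R fun i => Term.var (x i)
    have hφ : BoundedFormula.IsQF φ := (BoundedFormula.IsAtomic.rel _ _).isQF
    have hφM : φ.Realize (id : M → M) ↔ Structure.RelMap R x := by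
      simp [φ, Formula.realize_rel]
    have hφN : φ.Realize g ↔ Structure.RelMap R (g ∘ x) := by
      simp only [φ, Formula.realize_rel]
      exact Iff.rfl
    constructor
    · intro h
      by_contra hR
      have h2 := hg (∼φ) hφ.not (fun h => hR (hφM.1 h))
      exact h2 (hφN.2 h)
    · intro h
      exact hφN.1 (hg φ hφ (hφM.2 h))

theorem isExistential_exs {α : Type*} : ∀ {n : ℕ} (φ : L.BoundedFormula α n),
    φ.IsExistential → BoundedFormula.IsExistential φ.exs
  | 0, _, h => h
  | _ + 1, φ, h => isExistential_exs φ.ex h.ex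

theorem IsQF.listInf {α : Type*} (l : List (L.Formula α))
    (h : ∀ φ ∈ l, BoundedFormula.IsQF φ) :
    BoundedFormula.IsQF (l.foldr (· ⊓ ·) ⊤ : L.Formula α) := by
  induction l with
  | nil => exact BoundedFormula.IsQF.top
  | cons φ l ih =>
    exact (h φ (by simp)).inf (ih fun ψ hψ => h ψ (by simp [hψ]))

theorem realize_listInf {α M : Type*} [L.Structure M] (l : List (L.Formula α)) (x : α → M) :
    (l.foldr (· ⊓ ·) ⊤ : L.Formula α).Realize x ↔ ∀ φ ∈ l, φ.Realize x := by
  simp only [Formula.Realize]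
  exact (BoundedFormula.realize_foldr_inf l x _)

/-- If `M` is an existentially closed model of `T`, then every extension of `M` that is a model
of `T` embeds over `M` into an elementary extension of `M`. -/
theorem IsExistentiallyClosed.exists_embedding {T : L.Theory} {M : Type (max u v w)}
    [Nonempty M] [L.Structure M] (hM : IsExistentiallyClosed.{u, v, w} T M)
    (N : Type (max u v w)) [Nonempty N] [L.Structure N] (hN : N ⊨ T) (f : M ↪[L] N) :
    ∃ (P : Type (max u v w)) (_ : L.Structure P) (_ : Nonempty P) (e : M ↪ₑ[L] P) (g : N ↪[L] P),
      ∀ m, g (f m) = e m := by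
  classical
  -- This is the quantifier-free diagram of `N`, in which the elements of `M` also occur under their
  -- own names.
  let Γ : Set (L.Formula (M ⊕ N)) :=
    {φ | BoundedFormula.IsQF φ ∧ φ.Realize (Sum.elim f id)}
  obtain ⟨P, iP, hP, e, g, hg⟩ := exists_realize_type.{u, v, max u v w, max u v w} M Γ (by
    intro Γ₀ hΓ₀
    let χ : L.Formula (M ⊕ N) := Γ₀.toList.foldr (· ⊓ ·) ⊤
    have hχ : BoundedFormula.IsQF χ :=
      IsQF.listInf _ fun φ hφ => (hΓ₀ (Finset.mem_toList.1 hφ)).1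
    have hχN : χ.Realize (Sum.elim f id) :=
      (realize_listInf _ _).2 fun φ hφ => (hΓ₀ (Finset.mem_toList.1 hφ)).2
    -- Only finitely many elements of `N` occur in `χ`. The arbitrary element is a default value
    -- that makes `ret` total; the elements of `F` become the variables to be quantified.
    let F : Finset N := insert (Classical.arbitrary N) (χ.freeVarFinset.preimage Sum.inr
      Sum.inr_injective.injOn)
    let ret : N → Fin F.card := fun b =>
      F.equivFin (if hb : b ∈ F then ⟨b, hb⟩ else ⟨Classical.arbitrary N, by simp [F]⟩)
    have hret (b : N) (hb : b ∈ F) : (F.equivFin.symm (ret b)).1 = b := by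
      simp [ret, hb]
    let χ' : L.BoundedFormula M (F.card + 0) :=
      BoundedFormula.relabel (Sum.elim Sum.inl (Sum.inr ∘ ret)) χ
    have hrel {Q : Type (max u v w)} [L.Structure Q] (p : M → Q) (xs : Fin F.card → Q) :
        χ'.Realize p xs ↔ χ.Realize (Sum.elim p (xs ∘ ret)) := by
      refine BoundedFormula.realize_relabel.trans ?_
      have : (Sum.elim p (xs ∘ Fin.castAdd 0) ∘ Sum.elim Sum.inl (Sum.inr ∘ ret) : M ⊕ N → Q) =
          Sum.elim p (xs ∘ ret) := by
        funext a
        rcases a with a | a <;> rfl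
      exact iff_of_eq (congrArg₂ (BoundedFormula.Realize χ) this (Subsingleton.elim _ _))
    have hex : BoundedFormula.IsExistential (BoundedFormula.exs χ') :=
      isExistential_exs χ' (hχ.relabel _).isExistential
    have hN' : (BoundedFormula.exs χ').Realize f := by
      refine BoundedFormula.realize_exs.2 ⟨fun i => (F.equivFin.symm i).1, (hrel _ _).2 ?_⟩
      refine (realize_congr_freeVar χ ?_).1 hχN
      rintro (a | b) hb
      · rfl
      · exact (hret b (by simp [F, hb])).symm
    obtain ⟨xs, hxs⟩ := BoundedFormula.realize_exs.1
      (hM.2 (Theory.ModelType.of T N) f _ hex hN')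
    refine ⟨xs ∘ ret, fun γ hγ => ?_⟩
    exact (realize_listInf _ _).1 ((hrel _ _).1 hxs) γ (Finset.mem_toList.2 hγ))
  have hqf (φ : L.Formula N) (hφ : BoundedFormula.IsQF φ) (h : φ.Realize id) : φ.Realize g := by
    have h1 : (φ.relabel (Sum.inr : N → M ⊕ N) : L.Formula (M ⊕ N)).Realize (Sum.elim e g) :=
      hg _ ⟨hφ.relabel _, Formula.realize_relabel.2 h⟩
    have h2 := Formula.realize_relabel.1 h1
    exact h2
  refine ⟨P, iP, hP, e, embeddingOfQF g hqf, fun m => ?_⟩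
  let φ : L.Formula (M ⊕ N) := Term.equal (Term.var (Sum.inr (f m))) (Term.var (Sum.inl m))
  have := hg φ ⟨(BoundedFormula.IsAtomic.equal _ _).isQF, by simp [φ, Formula.realize_equal]⟩
  exact Formula.realize_equal.1 this

/-- An embedding between models of a model complete theory, as an elementary embedding. -/
def IsModelComplete.elementary {T : L.Theory} (hT : IsModelComplete.{u, v, w} T)
    {M N : Type (max u v w)} [Nonempty M] [Nonempty N] [L.Structure M] [L.Structure N]
    (hM : M ⊨ T) (hN : N ⊨ T) (f : M ↪[L] N) : M ↪ₑ[L] N where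
  toFun := f
  map_formula' := fun n φ a => hT (Theory.ModelType.of T M) (Theory.ModelType.of T N) f n φ a

end Types

/-! ### Structures for the language with `θ` -/

section ThetaStructures

variable {L : FirstOrder.Language.{u, v}} {r : ℕ}

/-- Compactness yields a bare structure for the joint language; the splitting recovers the
`L`-structure and the map `θ` on which the other statements depend. -/
theorem exists_sumStructure {L' : FirstOrder.Language} {M : Type*} (S : (L.sum L').Structure M) :
    ∃ (S₁ : L.Structure M) (S₂ : L'.Structure M), S = @sumStructure L L' M S₁ S₂ := by
  refine ⟨(LHom.sumInl : L →ᴸ L.sum L').reduct M, (LHom.sumInr : L' →ᴸ L.sum L').reduct M, ?_⟩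
  obtain ⟨f, R⟩ := S
  congr 1
  · funext n x
    rcases x with x | x <;> rfl
  · funext n x
    rcases x with x | x <;> rfl

/-- An `L`-embedding that commutes with `θ` is an `L ∪ {θ}`-embedding. -/
def thetaEmbedding {M N : Type*} [L.Structure M] [(thetaLang r).Structure M] [L.Structure N]
    [(thetaLang r).Structure N] (f : M ↪[L] N)
    (h : ∀ x : Fin r → M, thetaMap N (f ∘ x) = f ∘ thetaMap M x) : M ↪[withTheta L r] N where
  toFun := f
  inj' := f.injective
  map_fun' := by
    intro n F x
    rcases F with F | F
    · exact f.map_fun F x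
    · cases F with
      | coord j => exact (congrFun (h x) j).symm
  map_rel' := by
    intro n R x
    rcases R with R | R
    · exact f.map_rel R x
    · exact R.elim

/-- The `L`-embedding underlying an `L ∪ {θ}`-embedding. -/
def baseEmbedding {M N : Type*} [L.Structure M] [(thetaLang r).Structure M] [L.Structure N]
    [(thetaLang r).Structure N] (f : M ↪[withTheta L r] N) : M ↪[L] N where
  toFun := f
  inj' := f.injective
  map_fun' := fun F x => f.map_fun (Sum.inl F : (withTheta L r).Functions _) x
  map_rel' := fun R x => f.map_rel (Sum.inl R : (withTheta L r).Relations _) x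

theorem thetaMap_comp {M N : Type*} [L.Structure M] [(thetaLang r).Structure M] [L.Structure N]
    [(thetaLang r).Structure N] (f : M ↪[withTheta L r] N) (x : Fin r → M) :
    thetaMap N (f ∘ x) = f ∘ thetaMap M x := by
  funext j
  exact (f.map_fun (Sum.inr (ThetaFunctions.coord j) : (withTheta L r).Functions _) x).symm

/-- The elementary `L`-embedding underlying an elementary `L ∪ {θ}`-embedding. -/
def baseElementary {M N : Type*} [L.Structure M] [(thetaLang r).Structure M] [L.Structure N]
    [(thetaLang r).Structure N] (f : M ↪ₑ[withTheta L r] N) : M ↪ₑ[L] N where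
  toFun := f
  map_formula' := by
    intro n φ x
    have h := f.map_formula ((LHom.sumInl : L →ᴸ withTheta L r).onFormula φ) x
    rwa [LHom.realize_onFormula, LHom.realize_onFormula] at h

end ThetaStructures

end EndoVS

namespace EndoVS

open Polynomial

/-! ### Linear algebra of an endomorphism -/

section Algebra

variable {K : Type k} [Field K]

/-- A finite family in a module over `K[X]` generates the same submodule as a family whose
relations are those of a direct sum of cyclic modules. -/
theorem exists_cyclic_generators (Q : Type*) [AddCommGroup Q] [Module K[X] Q]
    [Module.Finite K[X] Q] :
    ∃ (m n : ℕ) (ξ : Fin n → K[X]) (x : Fin (m + n) → Q),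
      (∀ k, 0 < (ξ k).natDegree) ∧
      (∀ k, ξ k • x (Fin.natAdd m k) = 0) ∧
      (∀ A : Fin (m + n) → K[X], ∑ k, A k • x k = 0 →
        ∀ k, Fin.append (fun _ : Fin m => (0 : K[X])) ξ k ∣ A k) ∧
      ∀ q : Q, ∃ A : Fin (m + n) → K[X], ∑ k, A k • x k = q := by
  classical
  obtain ⟨m, ι, _, p, hp, e, ⟨E⟩⟩ := Module.equiv_free_prod_directSum K[X] Q
  -- The decomposition may contain summands with a unit `p i ^ e i`. They are trivial and are
  -- discarded, which secures positive degrees.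
  let J := {i : ι // 0 < (p i ^ e i).natDegree}
  let n := Fintype.card J
  let eJ : J ≃ Fin n := Fintype.equivFin J
  let ξ : Fin n → K[X] := fun k => p (eJ.symm k).1 ^ e (eJ.symm k).1
  let C : ι → Type k := fun i => K[X] ⧸ Submodule.span K[X] {p i ^ e i}
  let one : ∀ i, C i := fun i => Submodule.Quotient.mk 1
  have hsmul (i : ι) (a : K[X]) : (a • one i : C i) = Submodule.Quotient.mk a := by
    rw [← Submodule.Quotient.mk_smul, smul_eq_mul, mul_one]
  have hzero (i : ι) (a : K[X]) : (a • one i : C i) = 0 ↔ p i ^ e i ∣ a := by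
    rw [hsmul, Submodule.Quotient.mk_eq_zero, Submodule.mem_span_singleton]
    exact ⟨fun ⟨b, hb⟩ => ⟨b, by rw [← hb, smul_eq_mul, mul_comm]⟩,
      fun ⟨b, hb⟩ => ⟨b, by rw [hb, smul_eq_mul, mul_comm]⟩⟩
  let G : J → DirectSum ι C := fun j => DirectSum.lof K[X] ι C j.1 (one _)
  have hG (a : K[X]) (j : J) : a • G j = DirectSum.lof K[X] ι C j.1 (a • one _) :=
    (map_smul _ _ _).symm
  let x : Fin (m + n) → Q := Fin.append
    (fun l : Fin m => E.symm (Finsupp.single l 1, 0))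
    (fun k : Fin n => E.symm (0, G (eJ.symm k)))
  have hsum (A : Fin (m + n) → K[X]) : E (∑ k, A k • x k) =
      (∑ l : Fin m, Finsupp.single l (A (Fin.castAdd n l)),
        ∑ j : J, DirectSum.lof K[X] ι C j.1 (A (Fin.natAdd m (eJ j)) • one _)) := by
    rw [Fin.sum_univ_add, map_add, map_sum, map_sum]
    simp only [x, Fin.append_left, Fin.append_right, map_smul, LinearEquiv.apply_symm_apply]
    rw [← eJ.sum_comp]
    refine Prod.ext ?_ ?_
    · simp [Prod.fst_add, Prod.fst_sum]
    · simp only [Prod.snd_add, Prod.snd_sum, Prod.smul_snd, smul_zero, Finset.sum_const_zero,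
        zero_add, Equiv.symm_apply_apply, hG]
      exact Finset.sum_congr rfl fun j _ => map_smul _ _ _
  have hcomp (A : Fin (m + n) → K[X]) (j : J) :
      (∑ j : J, DirectSum.lof K[X] ι C j.1 (A (Fin.natAdd m (eJ j)) • one _)) j.1 =
        A (Fin.natAdd m (eJ j)) • one j.1 := by
    rw [DFinsupp.finsetSum_apply, Finset.sum_eq_single j]
    · exact DirectSum.lof_apply _ _ _
    · intro j' _ hj'
      exact DFinsupp.single_eq_of_ne fun h => hj' (Subtype.ext h.symm)
    · simp
  refine ⟨m, n, ξ, x, fun k => (eJ.symm k).2, fun k => ?_, fun A hA => ?_, fun q => ?_⟩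
  · apply E.injective
    have h0 : ξ k • one (eJ.symm k).1 = 0 := (hzero _ _).2 dvd_rfl
    simp only [x, Fin.append_right, map_smul, LinearEquiv.apply_symm_apply, map_zero,
      Prod.smul_mk, smul_zero, hG, h0]
    rfl
  · have h := hsum A
    rw [hA, map_zero] at h
    intro k
    refine Fin.addCases (fun l => ?_) (fun k => ?_) k
    · rw [Fin.append_left, zero_dvd_iff]
      have h1 := DFunLike.congr_fun (congrArg Prod.fst h) l
      simp only [Prod.fst_zero, Finsupp.coe_zero, Pi.zero_apply, Finsupp.finsetSum_apply,
        Finsupp.single_apply, Finset.sum_ite_eq', Finset.mem_univ, if_true] at h1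
      exact h1.symm
    · rw [Fin.append_right]
      have h1 := DFunLike.congr_fun (congrArg Prod.snd h) (eJ.symm k).1
      rw [hcomp A (eJ.symm k)] at h1
      have h2 := (hzero _ _).1 h1.symm
      rwa [Equiv.apply_symm_apply] at h2
  · have hrep (i : ι) : ∃ a : K[X], a • one i = (E q).2 i := by
      obtain ⟨a, ha⟩ := Submodule.Quotient.mk_surjective _ ((E q).2 i)
      exact ⟨a, (hsmul i a).trans ha⟩
    choose a ha using hrep
    refine ⟨Fin.append (fun l => (E q).1 l) (fun k => a (eJ.symm k).1), ?_⟩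
    apply E.injective
    rw [hsum]
    refine Prod.ext ?_ ?_
    · ext1 l
      simp
    · refine DFinsupp.ext fun i => ?_
      by_cases hi : 0 < (p i ^ e i).natDegree
      · rw [hcomp _ ⟨i, hi⟩, Fin.append_right, Equiv.symm_apply_apply]
        exact ha i
      · have hu : IsUnit (p i ^ e i) := by
          refine Polynomial.isUnit_iff_degree_eq_zero.2 ?_
          rw [Polynomial.degree_eq_natDegree (pow_ne_zero _ (hp i).ne_zero)]
          rw [Nat.eq_zero_of_not_pos hi, Nat.cast_zero]
        have hsub : Subsingleton (C i) := by
          refine ⟨fun b c => ?_⟩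
          have hb (b : C i) : b = 0 := by
            obtain ⟨b, rfl⟩ := Submodule.Quotient.mk_surjective _ b
            rw [← hsmul]
            exact (hzero _ _).2 hu.dvd
          rw [hb b, hb c]
        exact Subsingleton.elim (α := C i) _ _

/-- Generators with simple relations for finitely many vectors modulo an invariant subspace. -/
theorem exists_generators_mod {W : Type*} [AddCommGroup W] [Module K W] (θ : Module.End K W)
    (W₀ : Submodule K W) (hW₀ : ∀ w ∈ W₀, θ w ∈ W₀) (S : Finset W) :
    ∃ (m n : ℕ) (ξ : Fin n → K[X]) (x : Fin (m + n) → W),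
      (∀ k, 0 < (ξ k).natDegree) ∧
      (∀ k, aeval θ (ξ k) (x (Fin.natAdd m k)) ∈ W₀) ∧
      (∀ A : Fin (m + n) → K[X], ∑ k, aeval θ (A k) (x k) ∈ W₀ →
        ∀ k, Fin.append (fun _ : Fin m => (0 : K[X])) ξ k ∣ A k) ∧
      ∀ u ∈ S, ∃ A : Fin (m + n) → K[X], u - ∑ k, aeval θ (A k) (x k) ∈ W₀ := by
  let _ : Module K[X] W := Module.compHom W (aeval θ).toRingHom
  have hsm (a : K[X]) (w : W) : a • w = aeval θ a w := rfl
  have hinv (a : K[X]) (w : W) (hw : w ∈ W₀) : aeval θ a w ∈ W₀ := by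
    induction a using Polynomial.induction_on' with
    | add a b ha hb => simpa using W₀.add_mem ha hb
    | monomial n c =>
      rw [aeval_monomial]
      have : ∀ n : ℕ, (θ ^ n) w ∈ W₀ := by
        intro n
        induction n with
        | zero => simpa
        | succ n ih =>
          rw [pow_succ']
          exact hW₀ _ ih
      exact W₀.smul_mem c (this n)
  let W₁ : Submodule K[X] W :=
    { W₀.toAddSubmonoid with
      smul_mem' := fun a w hw => hinv a w hw }
  have hW₁ (w : W) : w ∈ W₁ ↔ w ∈ W₀ := Iff.rfl
  let Q : Submodule K[X] (W ⧸ W₁) := Submodule.span K[X] (W₁.mkQ '' S)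
  have : Module.Finite K[X] Q :=
    Module.Finite.span_of_finite K[X] ((Finset.finite_toSet S).image _)
  obtain ⟨m, n, ξ, y, hξ, hy, hdvd, hspan⟩ := exists_cyclic_generators (K := K) Q
  choose x hx using fun k => W₁.mkQ_surjective (y k).1
  have hmk (A : Fin (m + n) → K[X]) :
      W₁.mkQ (∑ k, aeval θ (A k) (x k)) = (∑ k, A k • y k : Q).1 := by
    rw [map_sum, AddSubmonoidClass.coe_finsetSum]
    refine Finset.sum_congr rfl fun k _ => ?_
    rw [← hsm, map_smul, hx]
    rfl
  refine ⟨m, n, ξ, x, hξ, fun k => ?_, fun A hA => ?_, fun u hu => ?_⟩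
  · rw [← hW₁, ← W₁.ker_mkQ, LinearMap.mem_ker, ← hsm, map_smul, hx]
    exact congrArg Subtype.val (hy k)
  · refine hdvd A (Subtype.ext ?_)
    rw [← hmk, ZeroMemClass.coe_zero, ← LinearMap.mem_ker, W₁.ker_mkQ]
    exact hA
  · obtain ⟨A, hA⟩ := hspan ⟨W₁.mkQ u, Submodule.subset_span ⟨u, hu, rfl⟩⟩
    refine ⟨A, ?_⟩
    rw [← hW₁, ← W₁.ker_mkQ, LinearMap.mem_ker, map_sub, hmk, hA, sub_self]

/-- An endomorphism of a subspace extends to the whole space in such a way that given vectors,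
which are independent over the subspace, become orbits that satisfy given polynomial
equations. -/
theorem exists_extension {W₀ W : Type*} [AddCommGroup W₀] [Module K W₀] [AddCommGroup W]
    [Module K W] (f : W₀ →ₗ[K] W) (hf : Function.Injective f) (θ : Module.End K W₀) {m n : ℕ}
    (ξ : Fin n → K[X]) (hξ : ∀ k, 0 < (ξ k).natDegree) (P : Fin n → Fin m → K[X])
    (v : Fin n → W₀) (x : Fin (m + n) × ℕ → W)
    (hx : ∀ c : (Fin (m + n) × ℕ) →₀ K, c ≠ 0 → ∀ d : W₀, (c.sum fun p q => q • x p) ≠ f d) :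
    ∃ θ' : Module.End K W, (∀ w, θ' (f w) = f (θ w)) ∧
      (∀ l i, (θ' ^ i) (x (Fin.castAdd n l, 0)) = x (Fin.castAdd n l, i)) ∧
      (∀ k i, i < (ξ k).natDegree →
        (θ' ^ i) (x (Fin.natAdd m k, 0)) = x (Fin.natAdd m k, i)) ∧
      ∀ k, aeval θ' (ξ k) (x (Fin.natAdd m k, 0)) =
        ∑ l, aeval θ' (P k l) (x (Fin.castAdd n l, 0)) + f (v k) := by
  classical
  -- The independence hypothesis says that `j` is injective. A left inverse `p` then allows values
  -- to be prescribed on the image of `j`, with zero on the kernel of `p`.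
  let j : W₀ × ((Fin (m + n) × ℕ) →₀ K) →ₗ[K] W :=
    f.coprod (Finsupp.linearCombination K x)
  have hj : LinearMap.ker j = ⊥ := by
    rw [LinearMap.ker_eq_bot']
    rintro ⟨w, c⟩ h
    have h1 : (c.sum fun p q => q • x p) = f (-w) := by
      rw [map_neg]
      exact eq_neg_of_add_eq_zero_right h
    have hc : c = 0 := by
      by_contra hc
      exact hx c hc _ h1
    subst hc
    rw [Finsupp.sum_zero_index] at h1
    have : -w = 0 := hf (by rw [← h1, map_zero])
    rw [neg_eq_zero.1 this]
    rfl
  obtain ⟨p, hp⟩ := j.exists_leftInverse_of_injective hj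
  -- Orbits are shifted. At index `deg ξ_k - 1` the equation is solved for its leading term; the
  -- same value at later indices is a default that never enters.
  let target : Fin (m + n) × ℕ → W := fun a => Fin.addCases
    (fun l => x (Fin.castAdd n l, a.2 + 1))
    (fun k => if a.2 + 1 < (ξ k).natDegree then x (Fin.natAdd m k, a.2 + 1) else
      ((ξ k).leadingCoeff)⁻¹ • ((∑ l, (P k l).sum fun i q => q • x (Fin.castAdd n l, i)) + f (v k)
        - ∑ i ∈ Finset.range (ξ k).natDegree, (ξ k).coeff i • x (Fin.natAdd m k, i))) a.1
  let θ' : Module.End K W := ((f ∘ₗ θ).coprod (Finsupp.linearCombination K target)) ∘ₗ p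
  have hpj (a) : p (j a) = a := LinearMap.congr_fun hp a
  have hθf (w : W₀) : θ' (f w) = f (θ w) := by
    have h1 : f w = j (w, 0) := by simp [j]
    simp only [θ', LinearMap.comp_apply]
    rw [h1, hpj]
    simp
  have hθx (a : Fin (m + n) × ℕ) : θ' (x a) = target a := by
    have h1 : x a = j (0, Finsupp.single a 1) := by simp [j]
    simp only [θ', LinearMap.comp_apply]
    rw [h1, hpj]
    simp
  have hl (l : Fin m) (i : ℕ) : (θ' ^ i) (x (Fin.castAdd n l, 0)) = x (Fin.castAdd n l, i) := by
    induction i with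
    | zero => simp
    | succ i ih =>
      rw [pow_succ', Module.End.mul_apply, ih, hθx]
      simp [target]
  have hk (k : Fin n) (i : ℕ) (hi : i < (ξ k).natDegree) :
      (θ' ^ i) (x (Fin.natAdd m k, 0)) = x (Fin.natAdd m k, i) := by
    induction i with
    | zero => simp
    | succ i ih =>
      rw [pow_succ', Module.End.mul_apply, ih (by omega), hθx]
      simp [target, hi]
  refine ⟨θ', hθf, hl, hk, fun k => ?_⟩
  have hP (l : Fin m) : aeval θ' (P k l) (x (Fin.castAdd n l, 0)) =
      (P k l).sum fun i q => q • x (Fin.castAdd n l, i) := by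
    rw [aeval_eq_sum_range, LinearMap.sum_apply,
      Polynomial.sum_over_range (P k l) (fun i => zero_smul K (x (Fin.castAdd n l, i)))]
    exact Finset.sum_congr rfl fun i _ => by rw [LinearMap.smul_apply, hl]
  have hd : (θ' ^ (ξ k).natDegree) (x (Fin.natAdd m k, 0)) =
      target (Fin.natAdd m k, (ξ k).natDegree - 1) := by
    obtain ⟨d, hd⟩ : ∃ d, (ξ k).natDegree = d + 1 := ⟨(ξ k).natDegree - 1, by have := hξ k; omega⟩
    rw [hd, pow_succ', Module.End.mul_apply, hk k d (by omega), hθx, Nat.add_sub_cancel]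
  have hlc : (ξ k).leadingCoeff ≠ 0 :=
    Polynomial.leadingCoeff_ne_zero.2 (Polynomial.ne_zero_of_natDegree_gt (hξ k))
  have htarget : (ξ k).leadingCoeff • target (Fin.natAdd m k, (ξ k).natDegree - 1) =
      (∑ l, (P k l).sum fun i q => q • x (Fin.castAdd n l, i)) + f (v k)
        - ∑ i ∈ Finset.range (ξ k).natDegree, (ξ k).coeff i • x (Fin.natAdd m k, i) := by
    have : ¬ ((ξ k).natDegree - 1 + 1 < (ξ k).natDegree) := by have := hξ k; omega
    simp only [target, Fin.addCases_right, this, if_false]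
    rw [smul_inv_smul₀ hlc]
  rw [aeval_eq_sum_range, Finset.sum_range_succ, LinearMap.add_apply, LinearMap.sum_apply,
    LinearMap.smul_apply, hd, Polynomial.coeff_natDegree, htarget]
  simp only [hP]
  have hsum : ∑ i ∈ Finset.range (ξ k).natDegree,
      ((ξ k).coeff i • θ' ^ i) (x (Fin.natAdd m k, 0)) =
      ∑ i ∈ Finset.range (ξ k).natDegree, (ξ k).coeff i • x (Fin.natAdd m k, i) :=
    Finset.sum_congr rfl fun i hi => by
      rw [LinearMap.smul_apply, hk k i (Finset.mem_range.1 hi)]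
  rw [hsum]
  abel

section Solutions

variable {W₀ W : Type*} [AddCommGroup W₀] [Module K W₀] [AddCommGroup W] [Module K W]
  {θ₀ : Module.End K W₀} {θ : Module.End K W} (f : W₀ →ₗ[K] W)

theorem aeval_map_of_commute (h : ∀ x, θ (f x) = f (θ₀ x)) (A : K[X]) (x : W₀) :
    aeval θ A (f x) = f (aeval θ₀ A x) := by
  have hpow (i : ℕ) : (θ ^ i) (f x) = f ((θ₀ ^ i) x) := by
    induction i with
    | zero => rfl
    | succ i ih => rw [pow_succ', pow_succ', Module.End.mul_apply, Module.End.mul_apply, ih, h]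
  rw [aeval_eq_sum_range, aeval_eq_sum_range, LinearMap.sum_apply, LinearMap.sum_apply, map_sum]
  exact Finset.sum_congr rfl fun i _ => by
    rw [LinearMap.smul_apply, LinearMap.smul_apply, map_smul, hpow]

variable {s : ℕ} (x : Fin s → W) (ζ : Fin s → K[X]) (v : Fin s → W₀)

/-- The coefficients of a combination of the `x k` can be reduced modulo the `ζ k`. -/
theorem exists_reduced_combination (h : ∀ x, θ (f x) = f (θ₀ x))
    (hx : ∀ k, aeval θ (ζ k) (x k) = f (v k)) (A : Fin s → K[X]) :
    ∃ w, ∑ k, aeval θ (A k) (x k) = ∑ k, aeval θ (A k % ζ k) (x k) + f w := by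
  refine ⟨∑ k, aeval θ₀ (A k / ζ k) (v k), ?_⟩
  rw [map_sum, ← Finset.sum_add_distrib]
  refine Finset.sum_congr rfl fun k _ => ?_
  rw [← aeval_map_of_commute f h, ← hx, ← Module.End.mul_apply, ← map_mul, ← LinearMap.add_apply,
    ← map_add, mul_comm, EuclideanDomain.mod_add_div]

/-- Solutions of the equations of a system of generators satisfy all the relations of these
generators. -/
theorem combination_eq_of_solution (h : ∀ x, θ (f x) = f (θ₀ x))
    (hx : ∀ k, aeval θ (ζ k) (x k) = f (v k)) (hf : Function.Injective f)
    (hdvd : ∀ A : Fin s → K[X], ∑ k, aeval θ (A k) (x k) ∈ LinearMap.range f → ∀ k, ζ k ∣ A k)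
    (x' : Fin s → W₀) (hx' : ∀ k, aeval θ₀ (ζ k) (x' k) = v k) (A : Fin s → K[X]) (w : W₀)
    (hA : ∑ k, aeval θ (A k) (x k) = f w) : ∑ k, aeval θ₀ (A k) (x' k) = w := by
  -- With `A k = ζ k * C k`, the combination equals `∑ C k • v k` in both modules, whatever the
  -- solution of the equations.
  choose C hC using hdvd A ⟨w, hA.symm⟩
  have h1 : ∑ k, aeval θ (A k) (x k) = f (∑ k, aeval θ₀ (C k) (v k)) := by
    rw [map_sum]
    refine Finset.sum_congr rfl fun k _ => ?_
    rw [hC, mul_comm, map_mul, Module.End.mul_apply, hx, aeval_map_of_commute f h]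
  rw [← hf (h1.symm.trans hA)]
  refine Finset.sum_congr rfl fun k _ => ?_
  rw [hC, mul_comm, map_mul, Module.End.mul_apply, hx']

end Solutions

/-- In an infinite vector space, a partial assignment that satisfies none of finitely many
nontrivial linear equations extends to a total assignment that satisfies none of them. -/
theorem exists_avoiding {W : Type*} [AddCommGroup W] [Module K W] [Infinite W] {ι : Type*}
    (D : Finset ((ι →₀ K) × W)) (F : Set ι) (x : ι → W)
    (hF : ∀ δ ∈ D, ↑δ.1.support ⊆ F → (δ.1.sum fun i q => q • x i) ≠ δ.2) :
    ∃ y : ι → W, (∀ i ∈ F, y i = x i) ∧ ∀ δ ∈ D, (δ.1.sum fun i q => q • y i) ≠ δ.2 := by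
  classical
  have key : ∀ G : Finset ι, ∃ y : ι → W, (∀ i ∈ F, y i = x i) ∧
      ∀ δ ∈ D, ↑δ.1.support ⊆ F ∪ G → (δ.1.sum fun i q => q • y i) ≠ δ.2 := by
    intro G
    induction G using Finset.induction_on with
    | empty => exact ⟨x, fun _ _ => rfl, by simpa using hF⟩
    | insert a G ha ih =>
      obtain ⟨y, hy, hyD⟩ := ih
      by_cases haF : a ∈ F
      · refine ⟨y, hy, fun δ hδ hs => hyD δ hδ fun i hi => ?_⟩
        rcases hs hi with h | h
        · exact Or.inl h
        · rcases Finset.mem_insert.1 (Finset.mem_coe.1 h) with rfl | h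
          · exact Or.inl haF
          · exact Or.inr h
      -- An equation in which `a` occurs excludes exactly one value at `a`, once the other
      -- coordinates are fixed; an infinite space has a value left.
      let bad : Finset W := D.image fun δ =>
        (δ.1 a)⁻¹ • (δ.2 - ((δ.1.erase a).sum fun i q => q • y i))
      obtain ⟨b, hb⟩ := Infinite.exists_notMem_finset bad
      have hupd (c : ι →₀ K) (hc : a ∉ c.support) :
          (c.sum fun i q => q • Function.update y a b i) = c.sum fun i q => q • y i := by
        refine Finset.sum_congr rfl fun i hi => ?_
        have : i ≠ a := fun h => hc (h ▸ hi)
        simp [Function.update_of_ne this]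
      refine ⟨Function.update y a b, fun i hi => ?_, fun δ hδ hs => ?_⟩
      · rw [Function.update_of_ne (fun h : i = a => haF (h ▸ hi)), hy i hi]
      · by_cases hda : a ∈ δ.1.support
        · intro h
          apply hb
          refine Finset.mem_image.2 ⟨δ, hδ, ?_⟩
          rw [← Finsupp.add_sum_erase δ.1 a _ hda, hupd _ (by simp), Function.update_self] at h
          rw [← h, add_sub_cancel_right, inv_smul_smul₀ (Finsupp.mem_support_iff.1 hda)]
        · rw [hupd _ hda]
          refine hyD δ hδ fun i hi => ?_
          rcases hs hi with h | h
          · exact Or.inl h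
          · rcases Finset.mem_insert.1 (Finset.mem_coe.1 h) with rfl | h
            · exact absurd hi hda
            · exact Or.inr h
  obtain ⟨y, hy, hyD⟩ := key (D.biUnion fun δ => δ.1.support)
  refine ⟨y, hy, fun δ hδ => hyD δ hδ fun i hi => Or.inr ?_⟩
  exact Finset.mem_coe.2 (Finset.mem_biUnion.2 ⟨δ, hδ, hi⟩)

end Algebra

end EndoVS

namespace EndoVS

open FirstOrder.Language

/-! ### Definable vector spaces -/

section Definable

variable {K : Type k} {L : FirstOrder.Language.{u, v}} {r : ℕ}
  (Ω : VectorSpaceFormulas K L r)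

/-- The coordinates of a family of vectors. -/
def coords {N ι : Type*} [L.Structure N] (x : ι → Ω.Vec N) (p : ι × Fin r) : N := (x p.1).1 p.2

/-- The formulas determine the operations. Hence an endomorphism that is linear for one choice of
the vector space structure can be used with the instances chosen for models of `T_θ`. -/
theorem VectorSpaceFormulas.Compatible.unique [Field K] {Ω : VectorSpaceFormulas K L r} {N : Type*}
    [L.Structure N] {A A' : AddCommGroup (Ω.Vec N)} {B : @Module K (Ω.Vec N) _ A.toAddCommMonoid}
    {B' : @Module K (Ω.Vec N) _ A'.toAddCommMonoid}
    (h : Ω.Compatible N A B) (h' : Ω.Compatible N A' B') : A = A' ∧ HEq B B' := by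
  have hA : A = A' := by
    refine AddCommGroup.ext (funext fun x => funext fun y => ?_)
    exact ((h'.add_iff ![x, y, A.add x y]).1 ((h.add_iff ![x, y, A.add x y]).2 rfl)).symm
  subst hA
  refine ⟨rfl, heq_of_eq (Module.ext' B B' fun q x => ?_)⟩
  exact ((h'.smul_iff q ![x, B.smul q x]).1 ((h.smul_iff q ![x, B.smul q x]).2 rfl)).symm

/-- `∃ z ∈ 𝕍 ^ κ, φ(x, z)`. -/
noncomputable def exVec {ι κ : Type*} [Finite κ] (φ : L.Formula ((ι ⊕ κ) × Fin r)) :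
    L.Formula (ι × Fin r) :=
  Formula.iExs (κ × Fin r) (φ.relabel (Equiv.sumProdDistrib ι κ (Fin r)) ⊓
    Formula.iInf fun i : κ => Ω.carrier.relabel fun j => Sum.inr (i, j))

theorem realize_exVec {ι κ N : Type*} [Finite κ] [L.Structure N]
    (φ : L.Formula ((ι ⊕ κ) × Fin r)) (x : ι → Ω.Vec N) :
    (exVec Ω φ).Realize (coords Ω x) ↔ ∃ z : κ → Ω.Vec N, φ.Realize (coords Ω (Sum.elim x z)) := by
  have hc (z : κ → Ω.Vec N) : Sum.elim (coords Ω x) (coords Ω z) ∘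
      Equiv.sumProdDistrib ι κ (Fin r) = coords Ω (Sum.elim x z) := by
    funext p
    rcases p with ⟨p | p, j⟩ <;> rfl
  simp only [exVec, Formula.realize_iExs, Formula.realize_inf, Formula.realize_iInf,
    Formula.realize_relabel]
  constructor
  · rintro ⟨z, hz, hm⟩
    let z' : κ → Ω.Vec N := fun i => ⟨fun j => z (i, j), hm i⟩
    refine ⟨z', ?_⟩
    rw [← hc z']
    exact hz
  · rintro ⟨z, hz⟩
    refine ⟨coords Ω z, ?_, fun i => (z i).2⟩
    rw [hc]
    exact hz

theorem realize_relabel_coords {ι κ N : Type*} [L.Structure N] (φ : L.Formula (ι × Fin r))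
    (g : ι → κ) (x : κ → Ω.Vec N) :
    (φ.relabel (Prod.map g id)).Realize (coords Ω x) ↔ φ.Realize (coords Ω (x ∘ g)) :=
  Formula.realize_relabel

/-- Linear equations `∑ cᵢ xᵢ = y` are uniformly definable. -/
theorem exists_linearFormula [Field K] {ι : Type*} (c : ι →₀ K) :
    ∃ φ : L.Formula (Option ι × Fin r), ∀ (N : Type w) [L.Structure N] [AddCommGroup (Ω.Vec N)]
      [Module K (Ω.Vec N)], Ω.Compatible N inferInstance inferInstance →
      ∀ x : Option ι → Ω.Vec N,
        φ.Realize (coords Ω x) ↔ (c.sum fun i q => q • x (some i)) = x none := by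
  induction c using Finsupp.induction with
  | zero =>
    refine ⟨Ω.zero.relabel fun j => (none, j), fun N _ _ _ hN x => ?_⟩
    rw [Formula.realize_relabel, Finsupp.sum_zero_index, eq_comm]
    exact hN.zero_iff (x none)
  | single_add a q c ha hq ih =>
    obtain ⟨φ, hφ⟩ := ih
    -- Two auxiliary vectors are quantified: `z 0` for the new summand `q • x a` and `z 1` for the
    -- rest of the sum.
    let smulF : L.Formula ((Option ι ⊕ Fin 2) × Fin r) :=
      (Ω.smul q).relabel (Prod.map ![Sum.inl (some a), Sum.inr 0] id)
    let addF : L.Formula ((Option ι ⊕ Fin 2) × Fin r) :=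
      Ω.add.relabel (Prod.map ![Sum.inr 0, Sum.inr 1, Sum.inl none] id)
    let sumF : L.Formula ((Option ι ⊕ Fin 2) × Fin r) :=
      φ.relabel (Prod.map (fun o => o.elim (Sum.inr 1) fun i => Sum.inl (some i)) id)
    refine ⟨exVec Ω (smulF ⊓ (sumF ⊓ addF)), fun N _ _ _ hN x => ?_⟩
    have h1 (z : Fin 2 → Ω.Vec N) : smulF.Realize (coords Ω (Sum.elim x z)) ↔
        q • x (some a) = z 0 :=
      (realize_relabel_coords Ω _ _ _).trans (hN.smul_iff q _)
    have h2 (z : Fin 2 → Ω.Vec N) : addF.Realize (coords Ω (Sum.elim x z)) ↔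
        z 0 + z 1 = x none :=
      (realize_relabel_coords Ω _ _ _).trans (hN.add_iff _)
    have h3 (z : Fin 2 → Ω.Vec N) : sumF.Realize (coords Ω (Sum.elim x z)) ↔
        (c.sum fun i q => q • x (some i)) = z 1 :=
      (realize_relabel_coords Ω _ _ _).trans (hφ N hN _)
    rw [realize_exVec]
    simp only [Formula.realize_inf, h1, h2, h3]
    rw [Finsupp.sum_add_index' (fun i => zero_smul K (x (some i)))
      (fun i b c => add_smul b c (x (some i))), Finsupp.sum_single_index (h := fun i q => q • x (some i)) (zero_smul K _)]
    constructor
    · rintro ⟨z, hz0, hz1, hz⟩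
      rw [hz0, hz1, hz]
    · intro h
      exact ⟨![q • x (some a), c.sum fun i q => q • x (some i)], rfl, rfl, h⟩

/-- Linear equations `∑ cᵢ xᵢ = d` with a parameter `d` are uniformly definable. -/
theorem exists_linearFormula_param [Field K] {ι : Type*} (c : ι →₀ K) {M : Type w} [L.Structure M]
    (d : Ω.Vec M) :
    ∃ φ : L.Formula (M ⊕ (ι × Fin r)), ∀ (N : Type w) [L.Structure N] [AddCommGroup (Ω.Vec N)]
      [Module K (Ω.Vec N)], Ω.Compatible N inferInstance inferInstance →
      ∀ (p : M → N) (d' : Ω.Vec N), d'.1 = p ∘ d.1 → ∀ x : ι → Ω.Vec N,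
        φ.Realize (Sum.elim p (coords Ω x)) ↔ (c.sum fun i q => q • x i) = d' := by
  obtain ⟨φ, hφ⟩ := exists_linearFormula.{u, v, w} Ω c
  refine ⟨φ.relabel fun p => p.1.elim (Sum.inl (d.1 p.2)) fun i => Sum.inr (i, p.2),
    fun N _ _ _ hN p d' hd x => ?_⟩
  refine Formula.realize_relabel.trans ?_
  refine Iff.trans (iff_of_eq (congrArg _ (funext fun a => ?_))) (hφ N hN fun o => o.elim d' x)
  rcases a with ⟨_ | i, j⟩
  · exact (congrFun hd j).symm
  · rfl

variable {Ω} {M N : Type*} [L.Structure M] [L.Structure N]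

/-- The image of a vector under an elementary embedding. -/
def vecMap (Ω : VectorSpaceFormulas K L r) (f : M ↪ₑ[L] N) (x : Ω.Vec M) : Ω.Vec N :=
  ⟨f ∘ x.1, (f.map_formula _ _).2 x.2⟩

theorem coords_vecMap {ι : Type*} (f : M ↪ₑ[L] N) (x : ι → Ω.Vec M) :
    coords Ω (fun i => vecMap Ω f (x i)) = f ∘ coords Ω x := rfl

theorem vecMap_injective (f : M ↪ₑ[L] N) : Function.Injective (vecMap Ω f) := by
  intro x y h
  refine Subtype.ext (funext fun j => f.injective ?_)
  exact congrFun (congrArg Subtype.val h) j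

/-- An elementary embedding induces a linear map. -/
def vecMapₗ [Field K] [AddCommGroup (Ω.Vec M)] [Module K (Ω.Vec M)] [AddCommGroup (Ω.Vec N)]
    [Module K (Ω.Vec N)] (hM : Ω.Compatible M inferInstance inferInstance)
    (hN : Ω.Compatible N inferInstance inferInstance) (f : M ↪ₑ[L] N) :
    Ω.Vec M →ₗ[K] Ω.Vec N where
  toFun := vecMap Ω f
  map_add' x y := by
    let a : Fin 3 → Ω.Vec M := ![x, y, x + y]
    have h := (f.map_formula Ω.add (coords Ω a)).2 ((hM.add_iff a).2 rfl)
    exact ((hN.add_iff fun i => vecMap Ω f (a i)).1 h).symm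
  map_smul' q x := by
    let a : Fin 2 → Ω.Vec M := ![x, q • x]
    have h := (f.map_formula (Ω.smul q) (coords Ω a)).2 ((hM.smul_iff q a).2 rfl)
    exact ((hN.smul_iff q fun i => vecMap Ω f (a i)).1 h).symm

end Definable

section Transfer

variable {K : Type k} [Field K] {L : FirstOrder.Language.{u, v}} {r : ℕ}
  {Ω : VectorSpaceFormulas K L r} {M N : Type w} [L.Structure M] [L.Structure N]
  [AddCommGroup (Ω.Vec M)] [Module K (Ω.Vec M)] [AddCommGroup (Ω.Vec N)] [Module K (Ω.Vec N)]

/-- If a formula implies a finite disjunction of linear dependencies in `M`, then it does so in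
every elementary extension of `M`. -/
theorem dependency_transfer (hM : Ω.Compatible M inferInstance inferInstance)
    (hN : Ω.Compatible N inferInstance inferInstance) (f : M ↪ₑ[L] N) {ι : Type*}
    (χ : L.Formula (M ⊕ (ι × Fin r))) (D : Finset ((ι →₀ K) × Ω.Vec M))
    (hD : ∀ x : ι → Ω.Vec M, χ.Realize (Sum.elim id (coords Ω x)) →
      ∃ δ ∈ D, (δ.1.sum fun i q => q • x i) = δ.2)
    (x : ι → Ω.Vec N) (hx : χ.Realize (Sum.elim f (coords Ω x))) :
    ∃ δ ∈ D, (δ.1.sum fun i q => q • x i) = vecMap Ω f δ.2 := by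
  classical
  by_contra hcon
  push Not at hcon
  choose lf hlf using fun δ : (ι →₀ K) × Ω.Vec M => exists_linearFormula_param.{u, v, w} Ω δ.1 δ.2
  -- Only finitely many vector variables matter to `χ` and `D`. All others are replaced by the zero
  -- vector, so that a counterexample in `N` is a finite tuple, which elementarity brings down to
  -- `M`.
  let F : Finset ι := (D.biUnion fun δ => δ.1.support) ∪
    (χ.freeVarFinset.preimage Sum.inr Sum.inr_injective.injOn).image Prod.fst
  let sub : M ⊕ (ι × Fin r) → M ⊕ (F × Fin r) := Sum.elim Sum.inl fun p =>
    if h : p.1 ∈ F then Sum.inr (⟨p.1, h⟩, p.2) else Sum.inl ((0 : Ω.Vec M).1 p.2)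
  let lin (δ : (ι →₀ K) × Ω.Vec M) : L.Formula (M ⊕ (F × Fin r)) :=
    (lf δ).relabel sub
  let Φ : L.Formula (M ⊕ (F × Fin r)) := χ.relabel sub ⊓
    ((Formula.iInf fun i : F => Ω.carrier.relabel fun j => Sum.inr (i, j)) ⊓
      Formula.iInf fun δ : D => ∼(lin δ))
  have h0 : vecMap Ω f 0 = 0 := (vecMapₗ hM hN f).map_zero
  let ext {P : Type w} [L.Structure P] [AddCommGroup (Ω.Vec P)] (y : F → Ω.Vec P) : ι → Ω.Vec P :=
    fun i => if h : i ∈ F then y ⟨i, h⟩ else 0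
  have hsub {P : Type w} [L.Structure P] [AddCommGroup (Ω.Vec P)] (p : M → P)
      (hp : p ∘ (0 : Ω.Vec M).1 = (0 : Ω.Vec P).1) (y : F → Ω.Vec P) :
      Sum.elim p (coords Ω y) ∘ sub = Sum.elim p (coords Ω (ext y)) := by
    funext a
    rcases a with a | ⟨i, j⟩
    · rfl
    · by_cases h : i ∈ F
      · simp [sub, ext, h, coords]
      · simp only [sub, ext, h, coords, Function.comp_apply, Sum.elim_inr, dif_neg, not_false_eq_true,
          Sum.elim_inl]
        exact congrFun hp j
  have hlin {P : Type w} [L.Structure P] [AddCommGroup (Ω.Vec P)] [Module K (Ω.Vec P)]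
      (hP : Ω.Compatible P inferInstance inferInstance) (p : M ↪ₑ[L] P)
      (hp : p ∘ (0 : Ω.Vec M).1 = (0 : Ω.Vec P).1) (y : F → Ω.Vec P)
      (δ : (ι →₀ K) × Ω.Vec M) : (lin δ).Realize (Sum.elim p (coords Ω y)) ↔
        (δ.1.sum fun i q => q • ext y i) = vecMap Ω p δ.2 := by
    refine Formula.realize_relabel.trans ?_
    rw [hsub p hp y]
    exact hlf δ P hP p (vecMap Ω p δ.2) rfl (ext y)
  have hΦ {P : Type w} [L.Structure P] [AddCommGroup (Ω.Vec P)] [Module K (Ω.Vec P)]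
      (hP : Ω.Compatible P inferInstance inferInstance) (p : M ↪ₑ[L] P)
      (hp : p ∘ (0 : Ω.Vec M).1 = (0 : Ω.Vec P).1) (y : F → Ω.Vec P) :
      Φ.Realize (Sum.elim p (coords Ω y)) ↔ χ.Realize (Sum.elim p (coords Ω (ext y))) ∧
        ∀ δ ∈ D, (δ.1.sum fun i q => q • ext y i) ≠ vecMap Ω p δ.2 := by
    simp only [Φ, Formula.realize_inf, Formula.realize_iInf, Formula.realize_not, hlin hP p hp,
      Formula.realize_relabel, hsub p hp]
    exact ⟨fun h => ⟨h.1, fun δ hδ => h.2.2 ⟨δ, hδ⟩⟩,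
      fun h => ⟨h.1, fun i => (y i).2, fun δ => h.2 δ δ.2⟩⟩
  have hNF : Φ.Realize (Sum.elim f (coords Ω fun i : F => x i)) := by
    refine (hΦ hN f (congrArg Subtype.val h0) _).2 ⟨?_, fun δ hδ => ?_⟩
    · refine (realize_congr_freeVar χ ?_).1 hx
      rintro (a | ⟨i, j⟩) ha
      · rfl
      · have : i ∈ F := Finset.mem_union_right _ (Finset.mem_image.2 ⟨(i, j), by simpa using ha, rfl⟩)
        simp [coords, ext, this]
    · convert hcon δ hδ using 1
      refine Finset.sum_congr rfl fun i hi => ?_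
      have : i ∈ F := Finset.mem_union_left _ (Finset.mem_biUnion.2 ⟨δ, hδ, hi⟩)
      simp [ext, this]
  obtain ⟨y, hy⟩ := exists_realize_of_elementary f Φ _ hNF
  have hmem (i : F) : Ω.carrier.Realize fun j => y (i, j) := by
    have h1 := (Formula.realize_inf.1 (Formula.realize_inf.1 hy).2).1
    have h2 := Formula.realize_relabel.1 (Formula.realize_iInf.1 h1 i)
    exact h2
  have hM' := (hΦ hM (ElementaryEmbedding.refl L M) rfl fun i => ⟨fun j => y (i, j), hmem i⟩).1 hy
  obtain ⟨δ, hδ, h⟩ := hD _ hM'.1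
  exact hM'.2 δ hδ h

end Transfer

end EndoVS

namespace EndoVS

open FirstOrder.Language Polynomial

/-! ### Coefficient families of tuples of polynomials -/

section Coefficients

variable {K : Type k} [Field K] {s : ℕ}

/-- The family of coefficients of a tuple of polynomials. -/
noncomputable def coeffs (A : Fin s → K[X]) : (Fin s × ℕ) →₀ K :=
  ∑ k, (A k).sum fun i q => Finsupp.single (k, i) q

theorem coeffs_apply (A : Fin s → K[X]) (p : Fin s × ℕ) : coeffs A p = (A p.1).coeff p.2 := by
  classical
  obtain ⟨k, i⟩ := p
  rw [coeffs, Finsupp.finsetSum_apply, Finset.sum_eq_single k]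
  · rw [Polynomial.sum_def, Finsupp.finsetSum_apply, Finset.sum_eq_single i]
    · simp
    · intro j _ hj
      simp [hj]
    · intro hi
      simpa using hi
  · intro l _ hl
    rw [Polynomial.sum_def, Finsupp.finsetSum_apply]
    exact Finset.sum_eq_zero fun j _ => by simp [hl]
  · simp

theorem exists_coeffs_eq (c : (Fin s × ℕ) →₀ K) : ∃ A : Fin s → K[X], coeffs A = c := by
  classical
  induction c using Finsupp.induction_linear with
  | zero => exact ⟨0, by ext p; simp [coeffs_apply]⟩
  | add c d hc hd =>
    obtain ⟨A, rfl⟩ := hc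
    obtain ⟨B, rfl⟩ := hd
    exact ⟨A + B, by ext p; simp [coeffs_apply]⟩
  | single a q =>
    refine ⟨Pi.single a.1 (monomial a.2 q), ?_⟩
    ext p
    rw [coeffs_apply]
    by_cases h : p.1 = a.1
    · rw [h, Pi.single_eq_same, coeff_monomial, Finsupp.single_apply]
      exact if_congr (by simp [Prod.ext_iff, h]) rfl rfl
    · rw [Pi.single_eq_of_ne h, coeff_zero, Finsupp.single_eq_of_ne fun h' => h (by rw [h'])]

/-- The condition on `ψ` speaks of linear combinations of orbit vectors, the structure theory of
polynomial combinations of generators; this identity translates between them. -/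
theorem sum_coeffs {W : Type*} [AddCommGroup W] [Module K W] (θ : Module.End K W)
    (x : Fin s → W) (A : Fin s → K[X]) :
    ((coeffs A).sum fun p q => q • (θ ^ p.2) (x p.1)) = ∑ k, aeval θ (A k) (x k) := by
  change Finsupp.linearCombination K (fun p : Fin s × ℕ => (θ ^ p.2) (x p.1)) (coeffs A) = _
  rw [coeffs, map_sum]
  refine Finset.sum_congr rfl fun k _ => ?_
  rw [Polynomial.sum_def, map_sum, aeval_eq_sum_range, LinearMap.sum_apply]
  simp only [Finsupp.linearCombination_single, LinearMap.smul_apply]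
  have h := Polynomial.sum_over_range (A k) (f := fun i q => q • (θ ^ i) (x k))
    fun i => zero_smul K _
  rwa [Polynomial.sum_def] at h

end Coefficients

/-! ### Models of `T_θ` -/

section ThetaModels

variable {K : Type k} [Field K] {L : FirstOrder.Language.{u, v}} {T : L.Theory} {r : ℕ}
  (V : DefinableVectorSpace.{u, v, w, k} K T r)

/-- Elementary embeddings preserve non-membership in `𝕍` and the zero vector, so for them commuting
with `θ` only needs to be checked on `𝕍`. -/
theorem thetaMap_of_not_mem {M : Type (max u v w)} [Nonempty M] [L.Structure M]
    [(thetaLang r).Structure M] [hM : M ⊨ V.thetaTheory] (x : Fin r → M)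
    (hx : ¬ V.carrier.Realize x) : thetaMap M x = (0 : V.Vec M).1 := by
  have h : M ⊨ V.axOutside := hM.realize_of_mem _ (Or.inl (Or.inr (Or.inr (Or.inr rfl))))
  have h1 := (realize_allClosure _).1 h (fun p => x p.2)
  simp only [Formula.realize_imp, Formula.realize_inf, Formula.realize_not, realize_memF,
    realize_zeroF] at h1
  obtain ⟨h2, h3⟩ := h1 hx
  exact congrArg Subtype.val (((compatible V M).zero_iff ⟨_, h2⟩).1 h3)

/-- Every endomorphism of `𝕍` in a model of `T` gives rise to a model of `T_θ`. -/
theorem exists_thetaStructure {N : Type (max u v w)} [Nonempty N] [L.Structure N] (hN : N ⊨ T)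
    [AddCommGroup (V.Vec N)] [Module K (V.Vec N)]
    (hc : V.Compatible N inferInstance inferInstance) (θ : Module.End K (V.Vec N)) :
    ∃ _ : (thetaLang r).Structure N, N ⊨ V.thetaTheory ∧
      ∀ x : V.Vec N, thetaMap N x.1 = (θ x).1 := by
  classical
  let t : (Fin r → N) → V.Vec N := fun x => if h : V.carrier.Realize x then θ ⟨x, h⟩ else 0
  let S : (thetaLang r).Structure N :=
    { funMap := fun F x => match F with
        | ThetaFunctions.coord j => (t x).1 j
      RelMap := fun R _ => R.elim }
  have ht (x : Fin r → N) : thetaMap N x = (t x).1 := rfl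
  have htv (x : V.Vec N) : t x.1 = θ x := dif_pos x.2
  refine ⟨S, Theory.model_iff _ |>.2 ?_, fun x => by rw [ht, htv]⟩
  rintro φ ((hφ | rfl | rfl | rfl) | ⟨q, rfl⟩)
  · have h : N ⊨ (LHom.sumInl : L →ᴸ withTheta L r).onTheory T := (LHom.onTheory_model _ T).2 hN
    exact h.realize_of_mem φ hφ
  · refine (realize_allClosure _).2 fun x => ?_
    simp only [Formula.realize_imp, realize_memF, realize_thetaTerm]
    intro _
    rw [ht]
    exact Subtype.property _
  · refine (realize_allClosure _).2 fun x => ?_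
    simp only [Formula.realize_imp, Formula.realize_inf, realize_memF, realize_addF]
    rintro ⟨⟨h0, h1⟩, h2⟩ hadd
    let a : Fin 3 → V.Vec N :=
      ![⟨fun j => x (0, j), h0⟩, ⟨fun j => x (1, j), h1⟩, ⟨fun j => x (2, j), h2⟩]
    have ha (i : Fin 3) : (a i).1 = fun j => x (i, j) := by fin_cases i <;> rfl
    have hsum : a 0 + a 1 = a 2 := by
      refine (hc.add_iff a).1 ?_
      convert hadd using 1
      funext p
      exact congrFun (ha p.1) p.2
    have h3 := (hc.add_iff fun i => θ (a i)).2 (by rw [← map_add, hsum])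
    convert h3 using 1
    funext p
    change thetaMap N (fun j => x (p.1, j)) p.2 = _
    rw [← ha, ht, htv]
  · refine (realize_allClosure _).2 fun x => ?_
    simp only [Formula.realize_imp, Formula.realize_inf, Formula.realize_not, realize_memF,
      realize_zeroF, realize_thetaTerm]
    intro hx
    have h0 : t (fun j => x (0, j)) = 0 := dif_neg hx
    change V.carrier.Realize (thetaMap N fun j => x (0, j)) ∧
      V.zero.Realize (thetaMap N fun j => x (0, j))
    rw [ht, h0]
    exact ⟨Subtype.property _, (hc.zero_iff 0).2 rfl⟩
  · refine (realize_allClosure _).2 fun x => ?_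
    simp only [Formula.realize_imp, Formula.realize_inf, realize_memF, realize_smulF]
    rintro ⟨h0, h1⟩ hsmul
    let a : Fin 2 → V.Vec N := ![⟨fun j => x (0, j), h0⟩, ⟨fun j => x (1, j), h1⟩]
    have ha (i : Fin 2) : (a i).1 = fun j => x (i, j) := by fin_cases i <;> rfl
    have hsum : q • a 0 = a 1 := by
      refine (hc.smul_iff q a).1 ?_
      convert hsmul using 1
      funext p
      exact congrFun (ha p.1) p.2
    have h3 := (hc.smul_iff q fun i => θ (a i)).2 (by rw [← map_smul, hsum])
    convert h3 using 1
    funext p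
    change thetaMap N (fun j => x (p.1, j)) p.2 = _
    rw [← ha, ht, htv]

/-- Every property of the vector space and its endomorphism that can be achieved in a model of
`T` can be achieved in a model of `T_θ` on the same `L`-structure. -/
theorem exists_thetaModel {N : Type (max u v w)} [Nonempty N] [L.Structure N] (hN : N ⊨ T)
    (A : AddCommGroup (V.Vec N)) (B : Module K (V.Vec N)) (hc : V.Compatible N A B)
    (Q : ∀ (_ : AddCommGroup (V.Vec N)) (_ : Module K (V.Vec N)), Module.End K (V.Vec N) → Prop)
    (θ : Module.End K (V.Vec N)) (hθ : Q A B θ) :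
    ∃ (_ : (thetaLang r).Structure N) (_ : N ⊨ V.thetaTheory), Q (instAddCommGroupVec V N) (instModuleVec V N) (theta V N) := by
  obtain ⟨S, hS, h⟩ := exists_thetaStructure V hN hc θ
  refine ⟨S, hS, ?_⟩
  obtain ⟨rfl, hB⟩ := hc.unique (compatible V N)
  obtain rfl := eq_of_heq hB
  have : theta V N = θ := LinearMap.ext fun x => Subtype.ext (h x)
  rwa [this]

section Maps

variable {M N : Type (max u v w)} [Nonempty M] [Nonempty N] [L.Structure M]
  [(thetaLang r).Structure M] [M ⊨ V.thetaTheory] [L.Structure N] [(thetaLang r).Structure N]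
  [N ⊨ V.thetaTheory]

/-- The linear map between the vector spaces of models of `T_θ` that is induced by an elementary
`L`-embedding. -/
noncomputable def vecHom (f : M ↪ₑ[L] N) : V.Vec M →ₗ[K] V.Vec N :=
  vecMapₗ (compatible V M) (compatible V N) f

theorem aeval_vecHom (f : M ↪ₑ[L] N) (h : ∀ x : V.Vec M, theta V N (vecHom V f x) =
      vecHom V f (theta V M x)) (A : K[X]) (x : V.Vec M) :
    aeval (theta V N) A (vecHom V f x) = vecHom V f (aeval (theta V M) A x) :=
  aeval_map_of_commute _ h A x

theorem pow_vecHom (f : M ↪ₑ[L] N) (h : ∀ x : V.Vec M, theta V N (vecHom V f x) =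
      vecHom V f (theta V M x)) (i : ℕ) (x : V.Vec M) :
    (theta V N ^ i) (vecHom V f x) = vecHom V f ((theta V M ^ i) x) := by
  simpa using aeval_vecHom V f h (X ^ i) x

theorem theta_vecHom (f : M ↪ₑ[L] N) (F : M ↪[withTheta L r] N) (hF : ∀ m, F m = f m)
    (x : V.Vec M) : theta V N (vecHom V f x) = vecHom V f (theta V M x) := by
  have hF' : (F : M → N) = f := funext hF
  refine Subtype.ext ?_
  have h := thetaMap_comp F x.1
  rw [hF'] at h
  exact h

end Maps

/-- The result of replacing `x_k^i` by `θ^i(x_k)`. -/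
noncomputable def thetaSubst {β : Type*} {s : ℕ} (χ : L.Formula (β ⊕ ((Fin s × ℕ) × Fin r))) :
    (withTheta L r).Formula (β ⊕ (Fin s × Fin r)) :=
  BoundedFormula.subst ((LHom.sumInl : L →ᴸ withTheta L r).onFormula χ)
    (Sum.elim (fun b => Term.var (Sum.inl b)) fun p =>
      thetaTerm^[p.1.2] (fun j => Term.var (Sum.inr (p.1.1, j))) p.2)

theorem realize_thetaSubst {M : Type (max u v w)} [Nonempty M] [L.Structure M]
    [(thetaLang r).Structure M] [M ⊨ V.thetaTheory] {β : Type*} {s : ℕ}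
    (χ : L.Formula (β ⊕ ((Fin s × ℕ) × Fin r))) (b : β → M) (x : Fin s → V.Vec M) :
    (thetaSubst χ).Realize (Sum.elim b (coords V.toVectorSpaceFormulas x)) ↔
      χ.Realize (Sum.elim b (coords V.toVectorSpaceFormulas
        fun p : Fin s × ℕ => (theta V M ^ p.2) (x p.1))) := by
  have hterm (k : Fin s) (i : ℕ) :
      (fun j => ((thetaTerm^[i] (fun j => Term.var (Sum.inr (k, j)))) j :
        (withTheta L r).Term (β ⊕ (Fin s × Fin r))).realize
          (Sum.elim b (coords V.toVectorSpaceFormulas x))) = ((theta V M ^ i) (x k)).1 := by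
    induction i with
    | zero => rfl
    | succ i ih =>
      rw [Function.iterate_succ_apply', realize_thetaTerm, ih, pow_succ', Module.End.mul_apply]
      rfl
  have hstep : (thetaSubst χ).Realize (Sum.elim b (coords V.toVectorSpaceFormulas x)) ↔
      ((LHom.sumInl : L →ᴸ withTheta L r).onFormula χ).Realize fun a => ((Sum.elim
        (fun b => Term.var (Sum.inl b)) fun p : (Fin s × ℕ) × Fin r =>
          thetaTerm^[p.1.2] (fun j => Term.var (Sum.inr (p.1.1, j))) p.2 :
            β ⊕ ((Fin s × ℕ) × Fin r) → (withTheta L r).Term (β ⊕ (Fin s × Fin r))) a).realize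
        (Sum.elim b (coords V.toVectorSpaceFormulas x)) :=
    BoundedFormula.realize_subst
  rw [hstep, LHom.realize_onFormula]
  refine iff_of_eq (congrArg _ (funext fun a => ?_))
  rcases a with a | ⟨⟨k, i⟩, j⟩
  · rfl
  · exact congrFun (hterm k i) j

end ThetaModels

end EndoVS

namespace EndoVS

open FirstOrder.Language Polynomial

/-! ### Existentially closed models satisfy the axioms -/

section Forward

variable {K : Type k} [Field K] {L : FirstOrder.Language.{u, v}} {T : L.Theory} {r : ℕ}
  (V : DefinableVectorSpace.{u, v, w, k} K T r)

/-- The formula `ψ` with its parameters as variables, and its variables grouped by vectors. -/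
def groupVars {M : Type*} {s : ℕ} (ψ : L[[M]].Formula (Fin s × ℕ × Fin r)) :
    L.Formula (M ⊕ ((Fin s × ℕ) × Fin r)) :=
  (paramsToVars ψ).relabel (Sum.map id fun p => ((p.1, p.2.1), p.2.2))

theorem realize_groupVars {M N : Type*} [L.Structure N] {s : ℕ}
    (ψ : L[[M]].Formula (Fin s × ℕ × Fin r)) (p : M → N) (x : Fin s × ℕ → V.Vec N) :
    (groupVars ψ).Realize (Sum.elim p (coords V.toVectorSpaceFormulas x)) ↔
      (paramsToVars ψ).Realize (Sum.elim p fun a => (x (a.1, a.2.1)).1 a.2.2) := by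
  refine Formula.realize_relabel.trans (iff_of_eq (congrArg _ (funext fun a => ?_)))
  rcases a with a | a <;> rfl

/-- A formula that does not imply a finite disjunction of linear dependencies is satisfied by a
family of vectors of an elementary extension that is independent over the vectors of `M`. -/
theorem exists_independent_realization {M : Type (max u v w)} [Nonempty M] [L.Structure M]
    [(thetaLang r).Structure M] [M ⊨ V.thetaTheory] {s : ℕ}
    (ψ : L[[M]].Formula (Fin s × ℕ × Fin r)) (hψ : ¬ ImpliesLinearDependency V ψ) :
    ∃ (N : Type (max u v w)) (_ : L.Structure N) (_ : Nonempty N) (e : M ↪ₑ[L] N)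
      (x : Fin s × ℕ → V.Vec N),
      (groupVars ψ).Realize (Sum.elim e (coords V.toVectorSpaceFormulas x)) ∧
      ∀ (A : AddCommGroup (V.Vec N)) (B : Module K (V.Vec N)), V.Compatible N A B →
        ∀ c : (Fin s × ℕ) →₀ K, c ≠ 0 → ∀ d : V.Vec M,
          (c.sum fun i q => q • x i) ≠ vecMap V.toVectorSpaceFormulas e d := by
  classical
  choose lin hlin using fun δ : ((Fin s × ℕ) →₀ K) × V.Vec M =>
    exists_linearFormula_param.{u, v, max u v w} V.toVectorSpaceFormulas δ.1 δ.2
  let mem (i : Fin s × ℕ) : L.Formula (M ⊕ ((Fin s × ℕ) × Fin r)) :=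
    V.carrier.relabel fun j => Sum.inr (i, j)
  let Γ : Set (L.Formula (M ⊕ ((Fin s × ℕ) × Fin r))) :=
    {φ | φ = groupVars ψ ∨ (∃ i, φ = mem i) ∨ ∃ δ, δ.1 ≠ 0 ∧ φ = ∼(lin δ)}
  obtain ⟨N, iN, hN, e, g, hg⟩ := exists_realize_type.{u, v, max u v w, 0} M Γ (by
    intro Γ₀ hΓ₀
    -- This recovers a dependency from its negation. The default `0` has zero coefficients and is
    -- removed by the filter in `D`.
    let pick (φ : L.Formula (M ⊕ ((Fin s × ℕ) × Fin r))) : ((Fin s × ℕ) →₀ K) × V.Vec M :=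
      if h : ∃ δ, δ.1 ≠ 0 ∧ φ = ∼(lin δ) then h.choose else 0
    let D := (Γ₀.image pick).filter fun δ => δ.1 ≠ 0
    have hD : ∃ x : Fin s × ℕ → V.Vec M, ψ.Realize (fun p => (x (p.1, p.2.1)).1 p.2.2) ∧
        ∀ δ ∈ D, (δ.1.sum fun p c => c • x p) ≠ δ.2 := by
      by_contra hcon
      push Not at hcon
      exact hψ ⟨D, fun δ hδ => (Finset.mem_filter.1 hδ).2, hcon⟩
    obtain ⟨x, hx, hxD⟩ := hD
    refine ⟨coords V.toVectorSpaceFormulas x, fun γ hγ => ?_⟩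
    rcases hΓ₀ hγ with rfl | ⟨i, rfl⟩ | h
    · exact (realize_groupVars V ψ id x).2 ((realize_paramsToVars ψ _).2 hx)
    · exact Formula.realize_relabel.2 (x i).2
    · have h1 : pick γ = h.choose := dif_pos h
      obtain ⟨h2, h3⟩ := h.choose_spec
      rw [← h1] at h2 h3
      rw [h3, Formula.realize_not]
      intro h4
      refine hxD (pick γ) (Finset.mem_filter.2 ⟨Finset.mem_image_of_mem _ hγ, h2⟩) ?_
      exact (hlin (pick γ) M (compatible V M) id (pick γ).2 rfl x).1 h4)
  have hmem (i : Fin s × ℕ) : V.carrier.Realize fun j => g (i, j) := by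
    have h1 := Formula.realize_relabel.1 (hg (mem i) (Or.inr (Or.inl ⟨i, rfl⟩)))
    exact h1
  refine ⟨N, iN, hN, e, fun i => ⟨fun j => g (i, j), hmem i⟩, hg _ (Or.inl rfl), ?_⟩
  intro A B hc c hc0 d h
  have h1 := hg (∼(lin (c, d))) (Or.inr (Or.inr ⟨(c, d), hc0, rfl⟩))
  exact h1 ((hlin (c, d) N hc e (vecMap V.toVectorSpaceFormulas e d) rfl _).2 h)

variable {V}

/-- The system is solved in an extension `N` built from an independent realization of `ψ`, carried
into an elementary extension `Q` of `M`, and pulled back to `M` as one first-order statement. -/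
theorem IsExistentiallyClosed.exists_solution (hT : IsModelComplete.{u, v, w} T)
    {M : Type (max u v w)} [Nonempty M] [L.Structure M] [(thetaLang r).Structure M]
    [M ⊨ V.thetaTheory] (hM : IsExistentiallyClosed.{u, v, w} V.thetaTheory M) {m n : ℕ}
    (ξ : Fin n → K[X]) (P : Fin n → Fin m → K[X]) (v : Fin n → V.Vec M)
    (ψ : L[[M]].Formula (Fin (m + n) × ℕ × Fin r)) (hξ : ∀ k, 0 < (ξ k).natDegree)
    (hψ : ¬ ImpliesLinearDependency V ψ)
    (hfree : ∀ (k : Fin n) (i : ℕ) (j : Fin r), (ξ k).natDegree ≤ i →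
      (Fin.natAdd m k, i, j) ∉ ψ.freeVarFinset) :
    ∃ x : Fin (m + n) → V.Vec M, RealizeTheta V ψ x ∧
      ∀ k : Fin n, aeval (theta V M) (ξ k) (x (Fin.natAdd m k)) =
        ∑ l : Fin m, aeval (theta V M) (P k l) (x (Fin.castAdd n l)) + v k := by
  classical
  obtain ⟨N, iN, hN, e, x, hx, hind⟩ := exists_independent_realization V ψ hψ
  have hTM : M ⊨ T := model_of_thetaTheory V M inferInstance
  have hTN : N ⊨ T := (e.theory_model_iff T).1 hTM
  obtain ⟨-, A, B, hAB⟩ := V.defineVectorSpace (Theory.ModelType.of T N)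
  obtain ⟨S, hSN, hcomm, hfr, htor, heq⟩ :
      ∃ (_ : (thetaLang r).Structure N) (_ : N ⊨ V.thetaTheory),
        (∀ w, theta V N (vecHom V e w) = vecHom V e (theta V M w)) ∧
        (∀ l i, (theta V N ^ i) (x (Fin.castAdd n l, 0)) = x (Fin.castAdd n l, i)) ∧
        (∀ k i, i < (ξ k).natDegree →
          (theta V N ^ i) (x (Fin.natAdd m k, 0)) = x (Fin.natAdd m k, i)) ∧
        ∀ k, aeval (theta V N) (ξ k) (x (Fin.natAdd m k, 0)) =
          ∑ l, aeval (theta V N) (P k l) (x (Fin.castAdd n l, 0)) + vecHom V e (v k) := by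
    obtain ⟨θ', h1, h2, h3, h4⟩ := exists_extension (vecMapₗ (compatible V M) hAB e)
      (vecMap_injective e) (theta V M) ξ hξ P v x (hind A B hAB)
    exact exists_thetaModel V hTN A B hAB (fun A B θ =>
      (∀ w, θ (vecMap V.toVectorSpaceFormulas e w) =
        vecMap V.toVectorSpaceFormulas e (theta V M w)) ∧
      (∀ l i, (θ ^ i) (x (Fin.castAdd n l, 0)) = x (Fin.castAdd n l, i)) ∧
      (∀ k i, i < (ξ k).natDegree →
        (θ ^ i) (x (Fin.natAdd m k, 0)) = x (Fin.natAdd m k, i)) ∧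
      ∀ k, aeval θ (ξ k) (x (Fin.natAdd m k, 0)) =
        ∑ l, aeval θ (P k l) (x (Fin.castAdd n l, 0)) +
          vecMap V.toVectorSpaceFormulas e (v k)) θ' ⟨h1, h2, h3, h4⟩
  let f : M ↪[withTheta L r] N := thetaEmbedding e.toEmbedding fun y => by
    by_cases hy : V.carrier.Realize y
    · exact congrArg Subtype.val (hcomm ⟨y, hy⟩)
    · have h1 : thetaMap N (e ∘ y) = (0 : V.Vec N).1 :=
        thetaMap_of_not_mem V _ fun h => hy ((e.map_formula _ _).1 h)
      rw [thetaMap_of_not_mem V y hy]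
      exact h1.trans (congrArg Subtype.val (vecHom V e).map_zero).symm
  obtain ⟨Q, iQ, hQ, e', g, hge⟩ := hM.exists_embedding N hSN f
  obtain ⟨iQ₁, iQ₂, rfl⟩ := exists_sumStructure iQ
  have hSQ : Q ⊨ V.thetaTheory := (e'.theory_model_iff _).1 inferInstance
  -- Model completeness enters here: `ψ` is arbitrary, and only an `L`-elementary map is sure to
  -- preserve it.
  let h : N ↪ₑ[L] Q :=
    hT.elementary hTN (model_of_thetaTheory V Q inferInstance) (baseEmbedding g)
  have hhe : (h ∘ e : M → Q) = e' := funext hge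
  have hcommQ := theta_vecHom V h g fun _ => rfl
  choose lin hlin using fun k : Fin n =>
    exists_linearFormula_param.{u, v, max u v w} V.toVectorSpaceFormulas
      (coeffs (Fin.append (fun l => -P k l) (Pi.single k (ξ k)))) (v k)
  have hlin' (N : Type (max u v w)) [L.Structure N] [(thetaLang r).Structure N] [Nonempty N]
      [N ⊨ V.thetaTheory] (p : M ↪ₑ[L] N) (k : Fin n) (y : Fin (m + n) → V.Vec N) :
      (lin k).Realize (Sum.elim p (coords V.toVectorSpaceFormulas
        fun a : Fin (m + n) × ℕ => (theta V N ^ a.2) (y a.1))) ↔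
      aeval (theta V N) (ξ k) (y (Fin.natAdd m k)) =
        ∑ l : Fin m, aeval (theta V N) (P k l) (y (Fin.castAdd n l)) + vecHom V p (v k) := by
    refine (hlin k N (compatible V N) p (vecHom V p (v k)) rfl _).trans ?_
    rw [sum_coeffs, Fin.sum_univ_add]
    simp only [Fin.append_left, Fin.append_right, map_neg, LinearMap.neg_apply,
      Finset.sum_neg_distrib]
    rw [Finset.sum_eq_single k (fun k' _ hk' => by rw [Pi.single_eq_of_ne hk']; simp) (by simp),
      Pi.single_eq_same, neg_add_eq_iff_eq_add]
  -- Membership in `𝕍` is included because the solution found in `M` is at first only a family of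
  -- tuples.
  let χ : L.Formula (M ⊕ ((Fin (m + n) × ℕ) × Fin r)) := groupVars ψ ⊓
    ((Formula.iInf lin) ⊓
      Formula.iInf fun k : Fin (m + n) => V.carrier.relabel fun j => Sum.inr ((k, 0), j))
  have hχ (N : Type (max u v w)) [L.Structure N] [(thetaLang r).Structure N] [Nonempty N]
      [N ⊨ V.thetaTheory] (p : M ↪ₑ[L] N) (y : Fin (m + n) → V.Vec N) :
      χ.Realize (Sum.elim p (coords V.toVectorSpaceFormulas
        fun a : Fin (m + n) × ℕ => (theta V N ^ a.2) (y a.1))) ↔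
      (groupVars ψ).Realize (Sum.elim p (coords V.toVectorSpaceFormulas
        fun a : Fin (m + n) × ℕ => (theta V N ^ a.2) (y a.1))) ∧
      ∀ k, aeval (theta V N) (ξ k) (y (Fin.natAdd m k)) =
        ∑ l : Fin m, aeval (theta V N) (P k l) (y (Fin.castAdd n l)) + vecHom V p (v k) := by
    simp only [χ, Formula.realize_inf, Formula.realize_iInf, hlin' N p]
    exact ⟨fun h => ⟨h.1, h.2.1⟩, fun h => ⟨h.1, h.2, fun k => Formula.realize_relabel.2 (y k).2⟩⟩
  let y : Fin (m + n) → V.Vec Q := fun k => vecHom V h (x (k, 0))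
  have hχQ : χ.Realize (Sum.elim e' (coords V.toVectorSpaceFormulas
      fun a : Fin (m + n) × ℕ => (theta V Q ^ a.2) (y a.1))) := by
    refine (hχ Q (baseElementary e') y).2 ⟨?_, fun k => ?_⟩
    · have h1 := (h.map_formula (groupVars ψ) _).2 hx
      rw [Sum.comp_elim, hhe, ← coords_vecMap, realize_groupVars] at h1
      -- The family `x` and the `θ`-orbits of the `x (k, 0)` may differ at indices beyond the
      -- degree, but by `hfree` those variables do not occur in `ψ`.
      refine (realize_groupVars V ψ _ _).2 ((realize_paramsToVars_congr ψ _ ?_).1 h1)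
      rintro ⟨k, i, j⟩ hk
      have h2 : (theta V N ^ i) (x (k, 0)) = x (k, i) := by
        induction k using Fin.addCases with
        | left l => exact hfr l i
        | right k =>
          refine htor k i ?_
          by_contra hi
          exact hfree k i j (not_lt.1 hi) hk
      simp only [y, pow_vecHom V h hcommQ, h2]
      rfl
    · have h1 := congrArg (vecHom V h) (heq k)
      rw [map_add, map_sum, ← aeval_vecHom V h hcommQ] at h1
      simp only [← aeval_vecHom V h hcommQ] at h1
      have h2 : vecHom V h (vecHom V e (v k)) = vecHom V (baseElementary e') (v k) :=
        Subtype.ext (funext fun j => congrFun hhe ((v k).1 j))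
      rw [h2] at h1
      exact h1
  obtain ⟨z, hz⟩ := exists_realize_of_elementary e' (thetaSubst χ) _
    ((realize_thetaSubst V χ e' y).2 hχQ)
  have hmem (k : Fin (m + n)) : V.carrier.Realize fun j => z (k, j) := by
    have h1 := BoundedFormula.realize_subst.1 hz
    have h2 := (LHom.realize_onFormula _ _).1 h1
    have h3 := (Formula.realize_inf.1 (Formula.realize_inf.1 h2).2).2
    have h4 := Formula.realize_relabel.1 (Formula.realize_iInf.1 h3 k)
    exact h4
  let z' : Fin (m + n) → V.Vec M := fun k => ⟨fun j => z (k, j), hmem k⟩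
  have hz' := (hχ M (ElementaryEmbedding.refl L M) z').1 ((realize_thetaSubst V χ id z').1 hz)
  exact ⟨z', (realize_paramsToVars ψ _).1 ((realize_groupVars V ψ id _).1 hz'.1), hz'.2⟩

end Forward

end EndoVS

namespace EndoVS

open FirstOrder.Language Polynomial

/-! ### Reflecting finite parts of an extension into a model of the axioms -/

section Backward

variable {K : Type k} [Field K] {L : FirstOrder.Language.{u, v}} {T : L.Theory} {r : ℕ}

/-- A map that preserves formulas is an elementary embedding. -/
def elementaryOfFormulas {M N : Type*} [L.Structure M] [L.Structure N] (g : M → N)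
    (hg : ∀ φ : L.Formula M, φ.Realize id → φ.Realize g) : M ↪ₑ[L] N where
  toFun := g
  map_formula' := by
    intro n φ x
    have key (χ : L.Formula (Fin n)) (h : χ.Realize x) : χ.Realize (g ∘ x) := by
      have h1 := hg (χ.relabel x) (Formula.realize_relabel.2 h)
      exact Formula.realize_relabel.1 h1
    refine ⟨fun h => ?_, key φ⟩
    by_contra hn
    exact Formula.realize_not.1 (key φ.not (Formula.realize_not.2 hn)) h

/-- If a definable vector space is finite, it has no new vectors in elementary extensions. -/
theorem vecMap_surjective_of_finite {Ω : VectorSpaceFormulas K L r} {M N : Type w} [L.Structure M]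
    [L.Structure N] [AddCommGroup (Ω.Vec M)] [Module K (Ω.Vec M)] [AddCommGroup (Ω.Vec N)]
    [Module K (Ω.Vec N)] (hM : Ω.Compatible M inferInstance inferInstance)
    (hN : Ω.Compatible N inferInstance inferInstance) (f : M ↪ₑ[L] N) [Finite (Ω.Vec M)] :
    Function.Surjective (vecMap Ω f) := by
  classical
  have := Fintype.ofFinite (Ω.Vec M)
  intro y
  -- Over a finite `𝕍(M)` even `⊤` implies a disjunction of dependencies, namely `x = d` for the
  -- finitely many `d`.
  obtain ⟨δ, hδ, h⟩ := dependency_transfer hM hN f (ι := Unit) ⊤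
    (Finset.univ.image fun d : Ω.Vec M => (Finsupp.single () (1 : K), d))
    (fun x _ => ⟨_, Finset.mem_image_of_mem _ (Finset.mem_univ (x ())), by simp⟩)
    (fun _ => y) (by simp)
  obtain ⟨d, -, rfl⟩ := Finset.mem_image.1 hδ
  exact ⟨d, by simpa using h.symm⟩

/-- The formula that expresses `∑ cᵢ xᵢ + w = g(u)` for vectors `xᵢ`, where the tuple `g(u)` is
required to be a vector. -/
theorem exists_combinationFormula (Ω : VectorSpaceFormulas K L r) {M β ι : Type*}
    [L.Structure M] (c : ι →₀ K) (w : Ω.Vec M) (u : Fin r → β) :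
    ∃ φ : L.Formula ((M ⊕ (ι × Fin r)) ⊕ β), ∀ (N : Type w) [L.Structure N]
      [AddCommGroup (Ω.Vec N)] [Module K (Ω.Vec N)], Ω.Compatible N inferInstance inferInstance →
      ∀ (p : M ↪ₑ[L] N) (x : ι → Ω.Vec N) (g : β → N),
        φ.Realize (Sum.elim (Sum.elim p (coords Ω x)) g) ↔
          ((c.sum fun i q => q • x i) + vecMap Ω p w).1 = g ∘ u := by
  obtain ⟨φ, hφ⟩ := exists_linearFormula.{u, v, w} Ω
    (c.mapDomain some + Finsupp.single none 1 : Option ι →₀ K)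
  -- The outer `none` stands for the right-hand side `g(u)`, the inner one for the constant vector
  -- `w`.
  let ρ : Option (Option ι) × Fin r → (M ⊕ (ι × Fin r)) ⊕ β := fun a =>
    a.1.elim (Sum.inr (u a.2)) fun o => o.elim (Sum.inl (Sum.inl (w.1 a.2))) fun i =>
      Sum.inl (Sum.inr (i, a.2))
  refine ⟨Ω.carrier.relabel (fun j => Sum.inr (u j)) ⊓ φ.relabel ρ,
    fun N _ _ _ hN p x g => ?_⟩
  have hsum (z : Option ι → Ω.Vec N) :
      ((c.mapDomain some + Finsupp.single none 1 : Option ι →₀ K).sum fun i q => q • z i) =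
        (c.sum fun i q => q • z (some i)) + z none := by
    rw [Finsupp.sum_add_index' (fun i => zero_smul K (z i)) (fun i a b => add_smul a b (z i)),
      Finsupp.sum_mapDomain_index (fun i => zero_smul K (z i)) (fun i a b => add_smul a b (z i)),
      Finsupp.sum_single_index (h := fun i q => q • z i) (zero_smul K _), one_smul]
  have hlin (hg : Ω.carrier.Realize (g ∘ u)) :
      (φ.relabel ρ).Realize (Sum.elim (Sum.elim p (coords Ω x)) g) ↔
        (c.sum fun i q => q • x i) + vecMap Ω p w = ⟨g ∘ u, hg⟩ := by
    let z : Option (Option ι) → Ω.Vec N := fun a =>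
      a.elim ⟨g ∘ u, hg⟩ fun o => o.elim (vecMap Ω p w) x
    have h1 := hφ N hN z
    rw [hsum] at h1
    refine Formula.realize_relabel.trans (Iff.trans (iff_of_eq (congrArg _ (funext fun a => ?_))) h1)
    rcases a with ⟨_ | _ | i, j⟩ <;> rfl
  rw [Formula.realize_inf]
  constructor
  · rintro ⟨h1, h2⟩
    have hg := Formula.realize_relabel.1 h1
    exact congrArg Subtype.val ((hlin hg).1 h2)
  · intro h
    have hg : Ω.carrier.Realize (g ∘ u) := by
      rw [← h]
      exact Subtype.property _
    exact ⟨Formula.realize_relabel.2 hg, (hlin hg).2 (Subtype.ext h)⟩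

variable (V : DefinableVectorSpace.{u, v, w, k} K T r)

section Reflect

variable {M N : Type (max u v w)} [Nonempty M] [Nonempty N] [L.Structure M]
  [(thetaLang r).Structure M] [M ⊨ V.thetaTheory] [L.Structure N] [(thetaLang r).Structure N]
  [N ⊨ V.thetaTheory]

/-- A formula that holds for vectors of an elementary extension whose orbits satisfy only trivial
linear dependencies over `M` does not imply a finite disjunction of linear dependencies. -/
theorem not_impliesLinearDependency (e : M ↪ₑ[L] N) {s : ℕ}
    (ψ : L[[M]].Formula (Fin s × ℕ × Fin r)) (F : Set (Fin s × ℕ)) (x : Fin s × ℕ → V.Vec N)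
    (hψ : ∀ y : Fin s × ℕ → V.Vec N, (∀ p ∈ F, y p = x p) →
      (groupVars ψ).Realize (Sum.elim e (coords V.toVectorSpaceFormulas y)))
    (hF : ∀ c : (Fin s × ℕ) →₀ K, ↑c.support ⊆ F → c ≠ 0 → ∀ d : V.Vec M,
      (c.sum fun p q => q • x p) ≠ vecHom V e d)
    (hfin : ∀ p, p ∉ F → ∃ y : V.Vec N, ∀ d : V.Vec M, y ≠ vecHom V e d) :
    ¬ ImpliesLinearDependency V ψ := by
  classical
  rintro ⟨D, hD0, hD⟩
  have htr := dependency_transfer (compatible V M) (compatible V N) e (groupVars ψ) D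
    fun y hy => hD y ((realize_paramsToVars ψ _).1 ((realize_groupVars V ψ id y).1 hy))
  let DN := D.image fun δ => (δ.1, vecHom V e δ.2)
  have hDN : ∀ δ ∈ DN, ↑δ.1.support ⊆ F → (δ.1.sum fun p q => q • x p) ≠ δ.2 := by
    intro δ hδ hs
    obtain ⟨δ, hδD, rfl⟩ := Finset.mem_image.1 hδ
    exact hF _ hs (hD0 δ hδD) _
  obtain ⟨y, hy, hyD⟩ : ∃ y : Fin s × ℕ → V.Vec N, (∀ p ∈ F, y p = x p) ∧
      ∀ δ ∈ DN, (δ.1.sum fun p q => q • y p) ≠ δ.2 := by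
    -- Coordinates outside `F` must be chosen to avoid finitely many equations, which needs an
    -- infinite space. If there are such coordinates, `hfin` gives a new vector of `N`, so `𝕍(M)`
    -- cannot be finite.
    by_cases hall : ∀ p, p ∈ F
    · exact ⟨x, fun _ _ => rfl, fun δ hδ => hDN δ hδ fun p _ => hall p⟩
    · push Not at hall
      obtain ⟨p, hp⟩ := hall
      obtain ⟨z, hz⟩ := hfin p hp
      have hinf : Infinite (V.Vec M) := by
        by_contra hM
        have hMf : Finite (V.Vec M) := not_infinite_iff_finite.1 hM
        obtain ⟨d, hd⟩ := vecMap_surjective_of_finite (compatible V M) (compatible V N) e z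
        exact hz d hd.symm
      have : Infinite (V.Vec N) := Infinite.of_injective _ (vecMap_injective e)
      exact exists_avoiding DN F x hDN
  obtain ⟨δ, hδ, h⟩ := htr y (hψ y hy)
  exact hyD _ (Finset.mem_image_of_mem _ hδ) h

/-- In a model of `T_θ` that satisfies the axioms, finitely many conditions that hold in an
extension can be satisfied. -/
theorem exists_finite_reflection
    (hsol : ∀ (m n : ℕ) (ξ : Fin n → K[X]) (v : Fin n → V.Vec M)
      (ψ : L[[M]].Formula (Fin (m + n) × ℕ × Fin r)), (∀ k, 0 < (ξ k).natDegree) →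
      ¬ ImpliesLinearDependency V ψ →
      (∀ (k : Fin n) (i : ℕ) (j : Fin r), (ξ k).natDegree ≤ i →
        (Fin.natAdd m k, i, j) ∉ ψ.freeVarFinset) →
      ∃ x : Fin (m + n) → V.Vec M, RealizeTheta V ψ x ∧
        ∀ k : Fin n, aeval (theta V M) (ξ k) (x (Fin.natAdd m k)) = v k)
    (e : M ↪ₑ[L] N) (hcomm : ∀ x, theta V N (vecHom V e x) = vecHom V e (theta V M x))
    (χ : L.Formula (M ⊕ N)) (hχ : χ.Realize (Sum.elim e id)) (S : Finset (V.Vec N)) :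
    ∃ g : N → M, χ.Realize (Sum.elim id g) ∧
      ∀ u ∈ S, thetaMap M (g ∘ u.1) = g ∘ (theta V N u).1 := by
  classical
  obtain ⟨m, n, ξ, x, hξ, htor, hdvd, hS⟩ := exists_generators_mod (theta V N)
    (LinearMap.range (vecHom V e))
    (by rintro _ ⟨w, rfl⟩; exact ⟨theta V M w, (hcomm w).symm⟩) S
  choose v hv using htor
  -- Free generators get the empty equation `0 = 0`, so that both kinds are treated alike; reduction
  -- modulo `0` changes nothing.
  let ζ : Fin (m + n) → K[X] := Fin.append (fun _ => 0) ξ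
  let v' : Fin (m + n) → V.Vec M := Fin.append (fun _ => 0) v
  have hζ (k) : aeval (theta V N) (ζ k) (x k) = vecHom V e (v' k) := by
    induction k using Fin.addCases with
    | left l => simp [ζ, v']
    | right k => simp [ζ, v', hv]
  have hζM (x' : Fin (m + n) → V.Vec M)
      (hx' : ∀ k, aeval (theta V M) (ξ k) (x' (Fin.natAdd m k)) = v k) (k) :
      aeval (theta V M) (ζ k) (x' k) = v' k := by
    induction k using Fin.addCases with
    | left l => simp [ζ, v']
    | right k => simp [ζ, v', hx']
  let F : Set (Fin (m + n) × ℕ) := {p | ∀ k : Fin n, p.1 = Fin.natAdd m k → p.2 < (ξ k).natDegree}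
  -- The images under `θ` are described as well, so that `θ` on `S` becomes a relation between
  -- generators.
  let S' : Finset (V.Vec N) := S ∪ S.image (theta V N)
  have hgen : ∀ u ∈ S', ∃ (A : Fin (m + n) → K[X]) (w : V.Vec M), u = ∑ k, aeval (theta V N) (A k) (x k) + vecHom V e w := by
    intro u hu
    rcases Finset.mem_union.1 hu with hu | hu
    · obtain ⟨A, w, hw⟩ := hS u hu
      exact ⟨A, w, by rw [hw]; abel⟩
    · obtain ⟨u, huS, rfl⟩ := Finset.mem_image.1 hu
      obtain ⟨A, w, hw⟩ := hS u huS
      refine ⟨fun k => X * A k, theta V M w, ?_⟩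
      simp only [map_mul, aeval_X, Module.End.mul_apply]
      rw [← hcomm, hw, ← map_sum, ← map_add]
      congr 1
      abel
  have hred : ∀ u : S', ∃ (A : Fin (m + n) → K[X]) (w : V.Vec M), u.1 = ∑ k, aeval (theta V N) (A k) (x k) + vecHom V e w ∧
      ↑(coeffs A).support ⊆ F := by
    rintro ⟨u, hu⟩
    obtain ⟨A, w, hAw⟩ := hgen u hu
    obtain ⟨w', hw'⟩ := exists_reduced_combination (vecHom V e) x ζ v' hcomm hζ A
    refine ⟨fun k => A k % ζ k, w' + w, ?_, ?_⟩
    · rw [map_add, ← add_assoc, ← hw']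
      exact hAw
    · rintro ⟨_, i⟩ hp k rfl
      rw [Finset.mem_coe, Finsupp.mem_support_iff, coeffs_apply] at hp
      simp only [ζ, Fin.append_right] at hp
      exact (Polynomial.le_natDegree_of_ne_zero hp).trans_lt
        (Polynomial.natDegree_mod_lt _ (hξ k).ne')
  choose A w hAw hAF using hred
  have hA' (u : S') {P : Type (max u v w)} [L.Structure P] [AddCommGroup (V.Vec P)]
      [Module K (V.Vec P)] (y : Fin (m + n) × ℕ → V.Vec P) :
      (((coeffs (A u)).subtypeDomain (· ∈ F)).sum fun p q => q • y p) =
        (coeffs (A u)).sum fun p q => q • y p :=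
    Finsupp.sum_subtypeDomain_index (h := fun p q => q • y p) fun p hp => hAF u hp
  let N₀ : Finset N := insert (Classical.arbitrary N)
    (χ.freeVarFinset.preimage Sum.inr Sum.inr_injective.injOn ∪
      S'.biUnion fun u => Finset.univ.image u.1)
  let ret : N → N₀ := fun b => if hb : b ∈ N₀ then ⟨b, hb⟩ else ⟨Classical.arbitrary N, by simp [N₀]⟩
  have hret (b : N) (hb : b ∈ N₀) : (ret b).1 = b := by simp [ret, hb]
  choose lin hlin using fun u : S' => exists_combinationFormula.{u, v, max u v w}
    V.toVectorSpaceFormulas ((coeffs (A u)).subtypeDomain (· ∈ F)) (w u) (ret ∘ u.1.1)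
  -- The formula says that the elements named by `N₀` can be chosen so that `χ` holds and every
  -- vector of `S'` is its prescribed combination of the generators. Only variables from `F` occur.
  let Ψ : L.Formula (M ⊕ (F × Fin r)) := Formula.iExs N₀
    ((χ.relabel (Sum.map Sum.inl ret) : L.Formula ((M ⊕ (F × Fin r)) ⊕ N₀)) ⊓ Formula.iInf lin)
  let ψ : L[[M]].Formula (Fin (m + n) × ℕ × Fin r) :=
    Formula.relabel (fun p : F × Fin r => (p.1.1.1, p.1.1.2, p.2))
      (BoundedFormula.constantsVarsEquiv.symm Ψ : L[[M]].Formula (F × Fin r))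
  have hψ {P : Type (max u v w)} [L.Structure P] [(thetaLang r).Structure P] [Nonempty P]
      [P ⊨ V.thetaTheory] (p : M ↪ₑ[L] P) (y : Fin (m + n) × ℕ → V.Vec P) :
      (groupVars ψ).Realize (Sum.elim p (coords V.toVectorSpaceFormulas y)) ↔
        ∃ g : N₀ → P, χ.Realize (Sum.elim p (g ∘ ret)) ∧ ∀ u : S',
          (((coeffs (A u)).sum fun p q => q • y p) + vecHom V p (w u)).1 = g ∘ ret ∘ u.1.1 := by
    rw [realize_groupVars, realize_paramsToVars_relabel, paramsToVars_symm, Formula.realize_iExs]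
    refine exists_congr fun g => ?_
    rw [Formula.realize_inf, Formula.realize_iInf, Formula.realize_relabel]
    refine and_congr (iff_of_eq (congrArg _ ?_)) (forall_congr' fun u => ?_)
    · funext a
      rcases a with a | a <;> rfl
    · rw [← hA' u y]
      exact hlin u P (compatible V P) p (fun i : F => y i) g
  have hnd : ¬ ImpliesLinearDependency V ψ := by
    refine not_impliesLinearDependency V e ψ F (fun p => (theta V N ^ p.2) (x p.1)) ?_ ?_ ?_
    · intro y hy
      refine (hψ e y).2 ⟨Subtype.val, ?_, fun u => ?_⟩
      · refine (realize_congr_freeVar χ ?_).1 hχ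
        rintro (a | b) hb
        · rfl
        · exact (hret b (by simp [N₀, hb])).symm
      · have h1 : ((coeffs (A u)).sum fun p q => q • y p) =
            ∑ k, aeval (theta V N) (A u k) (x k) := by
          rw [← sum_coeffs]
          exact Finset.sum_congr rfl fun p hp => congrArg _ (hy p (hAF u hp))
        rw [h1, ← hAw u]
        funext j
        refine (hret _ ?_).symm
        refine Finset.mem_insert_of_mem (Finset.mem_union_right _ ?_)
        exact Finset.mem_biUnion.2 ⟨u.1, u.2, Finset.mem_image_of_mem _ (Finset.mem_univ j)⟩
    -- A dependency over `𝕍(M)` forces `ζ k ∣ B k`. For free generators this means `B k = 0`; for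
    -- torsion generators the support in `F` keeps the degree below that of `ξ k`.
    · intro c hc hc0 d hd
      obtain ⟨B, rfl⟩ := exists_coeffs_eq c
      rw [sum_coeffs] at hd
      have h1 := hdvd B ⟨d, hd.symm⟩
      apply hc0
      ext p
      rw [coeffs_apply]
      suffices h2 : B p.1 = 0 by simp [h2]
      obtain ⟨k, i⟩ := p
      have h3 := h1 k
      induction k using Fin.addCases with
      | left l => simpa using h3
      | right k =>
        rw [Fin.append_right] at h3
        refine Polynomial.eq_zero_of_dvd_of_degree_lt h3 ?_
        rw [Polynomial.degree_eq_natDegree (Polynomial.ne_zero_of_natDegree_gt (hξ k)),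
          Polynomial.degree_lt_iff_coeff_zero]
        intro i hi
        by_contra hne
        exact absurd (hc (show (Fin.natAdd m k, i) ∈ _ by
          rwa [Finset.mem_coe, Finsupp.mem_support_iff, coeffs_apply]) k rfl) (not_lt.2 hi)
    · rintro ⟨k, i⟩ hp
      simp only [F, Set.mem_ofPred_eq, not_forall] at hp
      obtain ⟨k, rfl, -⟩ := hp
      -- A torsion generator lies outside `𝕍(M)`, for otherwise `ξ k` would divide `1`.
      refine ⟨x (Fin.natAdd m k), fun d hd => ?_⟩
      have h1 := hdvd (Pi.single (Fin.natAdd m k) 1) ⟨d, by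
        rw [Finset.sum_eq_single (Fin.natAdd m k)
          (fun k' _ hk' => by rw [Pi.single_eq_of_ne hk']; simp) (by simp)]
        simp [hd]⟩ (Fin.natAdd m k)
      rw [Fin.append_right, Pi.single_eq_same] at h1
      exact (hξ k).ne' (Polynomial.natDegree_eq_zero_of_isUnit (isUnit_of_dvd_one h1))
  obtain ⟨x', hx', hx'v⟩ := hsol m n ξ v ψ hξ hnd (by
    intro k i j hi hmem
    obtain ⟨⟨p, j'⟩, -, hp⟩ := mem_freeVarFinset_relabel _ _ hmem
    simp only [Prod.mk.injEq] at hp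
    have := p.2 k hp.1
    rw [hp.2.1] at this
    omega)
  obtain ⟨g, hg, hgS⟩ := (hψ (ElementaryEmbedding.refl L M)
    (fun p => (theta V M ^ p.2) (x' p.1))).1 ((realize_groupVars V ψ id _).2
      ((realize_paramsToVars ψ _).2 hx'))
  refine ⟨g ∘ ret, hg, fun u hu => ?_⟩
  have huS : u ∈ S' := Finset.mem_union_left _ hu
  have hθS : theta V N u ∈ S' := Finset.mem_union_right _ (Finset.mem_image_of_mem _ hu)
  have hval (u : S') : (∑ k, aeval (theta V M) (A u k) (x' k) + w u).1 = (g ∘ ret) ∘ u.1.1 := by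
    rw [← sum_coeffs]
    exact hgS u
  have hN1 := hAw ⟨_, huS⟩
  have hN2 := hAw ⟨_, hθS⟩
  -- In `N`, applying `θ` to the expression for `u` must give the expression for `θ u`. This is a
  -- relation among the generators modulo `𝕍(M)`, so the solution `x'` satisfies it too.
  have hrel := combination_eq_of_solution (vecHom V e) x ζ v' hcomm hζ (vecMap_injective e)
    hdvd x' (hζM x' hx'v) (fun k => X * A ⟨_, huS⟩ k - A ⟨_, hθS⟩ k)
    (w ⟨_, hθS⟩ - theta V M (w ⟨_, huS⟩)) (by
      simp only [map_sub, map_mul, aeval_X, LinearMap.sub_apply, Module.End.mul_apply,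
        Finset.sum_sub_distrib]
      rw [← map_sum, ← hcomm]
      refine sub_eq_sub_iff_add_eq_add.2 ?_
      rw [← map_add]
      exact (congrArg _ hN1).symm.trans hN2 |>.trans (add_comm _ _))
  simp only [map_sub, map_mul, aeval_X, LinearMap.sub_apply, Module.End.mul_apply,
    Finset.sum_sub_distrib] at hrel
  have hM : theta V M (∑ k, aeval (theta V M) (A ⟨_, huS⟩ k) (x' k) + w ⟨_, huS⟩) =
      ∑ k, aeval (theta V M) (A ⟨_, hθS⟩ k) (x' k) + w ⟨_, hθS⟩ := by
    rw [map_add, map_sum]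
    exact (sub_eq_sub_iff_add_eq_add.1 hrel).trans (add_comm _ _)
  have h1 := congrArg Subtype.val hM
  rw [hval ⟨_, hθS⟩] at h1
  rw [← h1, ← hval ⟨_, huS⟩]
  rfl

end Reflect

end Backward

end EndoVS

namespace EndoVS

open FirstOrder.Language Polynomial

/-! ### Models of the axioms are existentially closed -/

section ExistentiallyClosed

variable {K : Type k} [Field K] {L : FirstOrder.Language.{u, v}} {T : L.Theory} {r : ℕ}
  {V : DefinableVectorSpace.{u, v, w, k} K T r}

/-- If finitely many conditions that hold in an extension can be satisfied, then the extension
embeds into an elementary extension. -/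
theorem exists_embedding_of_finite_reflection {M N : Type (max u v w)} [Nonempty M] [Nonempty N]
    [L.Structure M] [(thetaLang r).Structure M] [M ⊨ V.thetaTheory] [L.Structure N]
    [(thetaLang r).Structure N] [N ⊨ V.thetaTheory] (e : M ↪ₑ[L] N)
    (h : ∀ χ : L.Formula (M ⊕ N), χ.Realize (Sum.elim e id) → ∀ S : Finset (V.Vec N),
      ∃ g : N → M, χ.Realize (Sum.elim id g) ∧
        ∀ u ∈ S, thetaMap M (g ∘ u.1) = g ∘ (theta V N u).1) :
    ∃ (P : Type (max u v w)) (_ : (withTheta L r).Structure P) (e' : M ↪ₑ[withTheta L r] P)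
      (g : N ↪[withTheta L r] P), ∀ m, g (e m) = e' m := by
  classical
  let base : L.Formula (M ⊕ N) → (withTheta L r).Formula (M ⊕ N) := LHom.sumInl.onFormula
  let eqn (a : V.Vec N × Fin r) : (withTheta L r).Formula (M ⊕ N) :=
    Term.equal (thetaTerm (fun j => Term.var (Sum.inr (a.1.1 j))) a.2)
      (Term.var (Sum.inr ((theta V N a.1).1 a.2)))
  -- The full `L`-diagram of `N` is used, so the resulting map is `L`-elementary; the formulas `eqn`
  -- make it commute with `θ` on `𝕍`.
  let Γ₁ : Set (L.Formula (M ⊕ N)) := {χ | χ.Realize (Sum.elim e id)}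
  obtain ⟨P, iP, hP, e', g, hg⟩ := exists_realize_type.{u, v, max u v w, max u v w} M
    (base '' Γ₁ ∪ Set.range eqn) (by
      intro Γ₀ hΓ₀
      obtain ⟨s₁, hs₁, h₁⟩ := Finset.subset_set_image_iff.1
        (show ↑(Γ₀.filter (· ∈ base '' Γ₁)) ⊆ base '' Γ₁ from
          fun γ hγ => (Finset.mem_filter.1 hγ).2)
      obtain ⟨s₂, -, h₂⟩ := Finset.subset_set_image_iff.1
        (show ↑(Γ₀.filter (· ∈ Set.range eqn)) ⊆ eqn '' Set.univ from
          fun γ hγ => by rw [Set.image_univ]; exact (Finset.mem_filter.1 hγ).2)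
      obtain ⟨g, hg, hgS⟩ := h (s₁.toList.foldr (· ⊓ ·) ⊤)
        ((realize_listInf _ _).2 fun φ hφ => hs₁ (Finset.mem_toList.1 hφ)) (s₂.image Prod.fst)
      refine ⟨g, fun γ hγ => ?_⟩
      rcases hΓ₀ hγ with hγ' | hγ'
      · have h3 : γ ∈ s₁.image base := h₁ ▸ Finset.mem_filter.2 ⟨hγ, hγ'⟩
        obtain ⟨φ, hφ, rfl⟩ := Finset.mem_image.1 h3
        exact (LHom.realize_onFormula _ _).2
          ((realize_listInf _ _).1 hg φ (Finset.mem_toList.2 hφ))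
      · have h3 : γ ∈ s₂.image eqn := h₂ ▸ Finset.mem_filter.2 ⟨hγ, hγ'⟩
        obtain ⟨a, ha, rfl⟩ := Finset.mem_image.1 h3
        exact Formula.realize_equal.2
          (congrFun (hgS a.1 (Finset.mem_image_of_mem _ ha)) a.2))
  obtain ⟨iP₁, iP₂, rfl⟩ := exists_sumStructure iP
  have hSP : P ⊨ V.thetaTheory := (e'.theory_model_iff _).1 inferInstance
  have hbase (χ : L.Formula (M ⊕ N)) (hχ : χ.Realize (Sum.elim e id)) :
      χ.Realize (Sum.elim e' g) :=
    (LHom.realize_onFormula _ _).1 (hg (base χ) (Or.inl ⟨χ, hχ, rfl⟩))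
  let gE : N ↪ₑ[L] P := elementaryOfFormulas g fun φ hφ => by
    have h1 := hbase (φ.relabel Sum.inr) (Formula.realize_relabel.2 hφ)
    have h2 := Formula.realize_relabel.1 h1
    exact h2
  have hgvec (a : V.Vec N) : thetaMap P (g ∘ a.1) = g ∘ thetaMap N a.1 := by
    funext j
    exact Formula.realize_equal.1 (hg (eqn (a, j)) (Or.inr ⟨(a, j), rfl⟩))
  refine ⟨P, inferInstance, e', thetaEmbedding gE.toEmbedding fun y => ?_, fun m => ?_⟩
  · by_cases hy : V.carrier.Realize y
    · exact hgvec ⟨y, hy⟩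
    · have h1 : thetaMap P (gE ∘ y) = (0 : V.Vec P).1 :=
        thetaMap_of_not_mem V _ fun h => hy ((gE.map_formula _ _).1 h)
      rw [thetaMap_of_not_mem V y hy]
      exact h1.trans (congrArg Subtype.val (vecHom V gE).map_zero).symm
  · exact Formula.realize_equal.1 (hbase
      (Term.equal (Term.var (Sum.inr (e m))) (Term.var (Sum.inl m)))
      (Formula.realize_equal.2 rfl))

/-- Existential formulas go up along an embedding of `N` into an elementary extension `P` of `M`,
and come down from `P` to `M`. Constant right-hand sides suffice, since cyclic decompositions
produce only equations `ξ_k[θ](x_{m+k}) = v_k`. -/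
theorem isExistentiallyClosed_of_solutions (hT : IsModelComplete.{u, v, w} T)
    {M : Type (max u v w)} [Nonempty M] [L.Structure M] [(thetaLang r).Structure M]
    [hM : M ⊨ V.thetaTheory]
    (hsol : ∀ (m n : ℕ) (ξ : Fin n → K[X]) (v : Fin n → V.Vec M)
      (ψ : L[[M]].Formula (Fin (m + n) × ℕ × Fin r)), (∀ k, 0 < (ξ k).natDegree) →
      ¬ ImpliesLinearDependency V ψ →
      (∀ (k : Fin n) (i : ℕ) (j : Fin r), (ξ k).natDegree ≤ i →
        (Fin.natAdd m k, i, j) ∉ ψ.freeVarFinset) →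
      ∃ x : Fin (m + n) → V.Vec M, RealizeTheta V ψ x ∧
        ∀ k : Fin n, aeval (theta V M) (ξ k) (x (Fin.natAdd m k)) = v k) :
    IsExistentiallyClosed.{u, v, w} V.thetaTheory M := by
  refine ⟨hM, ?_⟩
  rintro (@⟨N, iN, hN, hN'⟩) f φ hφ hφN
  obtain ⟨iN₁, iN₂, rfl⟩ := exists_sumStructure iN
  change M ↪[withTheta L r] N at f
  let e : M ↪ₑ[L] N := hT.elementary (model_of_thetaTheory V M hM) (model_of_thetaTheory V N hN)
    (baseEmbedding f)
  obtain ⟨P, iP, e', g, hg⟩ := exists_embedding_of_finite_reflection e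
    (exists_finite_reflection V hsol e (theta_vecHom V e f fun _ => rfl))
  have h1 := hφ.realize_embedding g hφN
  have h2 : (g ∘ f : M → P) = e' ∘ id := funext hg
  refine (e'.map_formula φ id).1 ?_
  rw [← h2]
  exact (iff_of_eq (congrArg (BoundedFormula.Realize φ _) (Subsingleton.elim _ _))).1 h1

end ExistentiallyClosed

end EndoVS

theorem theorem3p40 {K : Type k} [Field K] {L : FirstOrder.Language.{u, v}} (T : L.Theory)
    (hT : EndoVS.IsModelComplete.{u, v, w} T) {r : ℕ}
    (V : EndoVS.DefinableVectorSpace.{u, v, w, k} K T r)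
    (M : Type (max u v w)) [Nonempty M] [L.Structure M] [(EndoVS.thetaLang r).Structure M]
    [M ⊨ V.thetaTheory] :
    EndoVS.IsExistentiallyClosed.{u, v, w} V.thetaTheory M ↔
      ∀ (m n : ℕ) (ξ : Fin n → Polynomial K) (P : Fin n → Fin m → Polynomial K)
        (v : Fin n → V.Vec M) (ψ : L[[M]].Formula (Fin (m + n) × ℕ × Fin r)),
        (∀ k, 0 < (ξ k).natDegree) →
        ¬ EndoVS.ImpliesLinearDependency V ψ →
        (∀ (k : Fin n) (i : ℕ) (j : Fin r), (ξ k).natDegree ≤ i →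
          (Fin.natAdd m k, i, j) ∉ ψ.freeVarFinset) →
        ∃ x : Fin (m + n) → V.Vec M,
          EndoVS.RealizeTheta V ψ x ∧
          ∀ k : Fin n, Polynomial.aeval (EndoVS.theta V M) (ξ k) (x (Fin.natAdd m k)) =
            ∑ l : Fin m,
              Polynomial.aeval (EndoVS.theta V M) (P k l) (x (Fin.castAdd n l)) + v k := by
  refine ⟨fun hM m n ξ P v ψ => hM.exists_solution hT ξ P v ψ, fun h => ?_⟩
  refine EndoVS.isExistentiallyClosed_of_solutions hT fun m n ξ v ψ hξ hψ hfree => ?_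
  -- The instances with `P = 0` already imply existential closedness.
  obtain ⟨x, hx, hx'⟩ := h m n ξ 0 v ψ hξ hψ hfree
  exact ⟨x, hx, fun k => by simpa using hx' k⟩
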